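/- Let $H$ be a nonzero complex Hilbert space (the probe, including any noiseless ancillae), let $L_1,\dots,L_R$ be bounded operators on $H$ and let $V$ be a parameter-independent unitary $R\times R$ matrix. For parameters $\theta\in\mathbb{R}^d$ let $\Gamma(\theta)=V\,\mathrm{diag}(\gamma_1(\theta),\dots,\gamma_R(\theta))\,V^\dagger$, where the eigenrates $\gamma_k$ are nonnegative near the true parameter point $\theta$ and the $\sqrt{\gamma_k}$ are differentiable at $\theta$ (eigenrate-only encoding). Put $J_k=\sum_i V_{ik}L_i$ and $\mathscr{D}_\theta(\rho)=\sum_{ij}\Gamma_{ij}(\theta)\big(L_i\rho L_j^\dagger-\tfrac12\{L_j^\dagger L_i,\rho\}\big)=\sum_k\gamma_k(\theta)\big(J_k\rho J_k^\dagger-\tfrac12\{J_k^\dagger J_k,\rho\}\big)$, and let $H_c(t)$ be a parameter-independent, locally integrable, bounded self-adjoint control Hamiltonian. For a unit vector $\psi\in H$ let $\Psi(\theta;t)=U(\theta;t)(\psi\otimes\mathrm{vac})$ be the collisional purification, where $U(\theta;t)=\mathcal{T}\exp\big(-i\int_0^t[H_c(s)+\sum_k(\sqrt{\gamma_k(\theta)}\,J_k\otimes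 e_k^\dagger(s)+\mathrm{h.c.})]\,ds\big)$ and the $e_k$ are independent white-noise bosonic bath modes in the vacuum. Explicitly, the amplitude in $\Psi(\theta;t)$ of $n$ bath quanta in the modes $k_1,\dots,k_n$ at the times $0<s_1<\dots<s_n<t$ is $G(t,s_n)(-i\sqrt{\gamma_{k_n}}J_{k_n})G(s_n,s_{n-1})\cdots(-i\sqrt{\gamma_{k_1}}J_{k_1})G(s_1,0)\psi$, with $G(t,s)=\mathcal{T}\exp\int_s^t\big(-iH_c(u)-\tfrac12\sum_k\gamma_kJ_k^\dagger J_k\big)du$. Let $(F_Q)_{\alpha\beta}(t;\psi)=4\,\mathrm{Re}\big(\langle\partial_\alpha\Psi|\partial_\beta\Psi\rangle-\langle\partial_\alpha\Psi|\Psi\rangle\langle\Psi|\partial_\beta\Psi\rangle\big)$ be its quantum Fisher information matrix at $\theta$, write $\bar F=\mathrm{Tr}\,F/d$ for averages per parameter, and define $$\mathcal{R}^\star=\sup_{t>0}\ \sup_{\|\psi\|=1}\ \frac{\bar F_Q(t;\psi)}{t},\qquad A=\sum_{k=1}^R c_kJ_k^\dagger J_k,\qquad c_k=\frac4d\sum_{\alpha=1}^d(\partial_\alpha\sqrt{\gamma_k})^2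 .$$ Then $A$ is positive, the supremum is finite, and $\mathcal{R}^\star=\lambda_{\max}(A)$, the largest element of the spectrum of $A$ (its largest eigenvalue if $\dim H<\infty$). For every unit vector $\psi$, $\bar F_Q(t;\psi)/t\to\langle\psi|A|\psi\rangle$ as $t\to0^+$. Suppose moreover that the unit vector $\psi^\star$ is maximizing, i.e. $\langle\psi^\star|A|\psi^\star\rangle=\mathcal{R}^\star$, and admits a distinguishable jump POVM: the vectors $\mathfrak{j}_k=J_k\psi^\star/\sqrt{\mu_k}$, with $\mu_k=\langle\psi^\star|J_k^\dagger J_k|\psi^\star\rangle\neq0$, are orthonormal and orthogonal to $\psi^\star$. Let $F_{\rm rpm}(\delta t;\psi^\star)$ be the classical Fisher information matrix at $\theta$ of one rapid prepare-and-measure (RPM) shot: prepare $\psi^\star$, evolve for a time $\delta t$ under $\dot\rho=\mathscr{D}_\theta(\rho)$ (no control), and measure the POVM $\{|\psi^\star\rangle\langle\psi^\star|,|\mathfrak{j}_1\rangle\langle\mathfrak{j}_1|,\dots,|\mathfrak{j}_R\rangle\langle\mathfrak{j}_R|,\Pi_\perp\}$, where $\Pi_\perp$ is the complementary projection. Then $$\lim_{\delta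 t\to0^+}\frac{\bar F_{\rm rpm}(\delta t;\psi^\star)}{\delta t}=\mathcal{R}^\star .$$ Consequently, for every total time $T>0$, $\nu$ independent shots of duration $T/\nu$ have average Fisher information $\nu\,\bar F_{\rm rpm}(T/\nu;\psi^\star)\to T\mathcal{R}^\star$ as $\nu\to\infty$, the optimal value for unlimited shots. -/

import Mathlib

open Filter Topology MeasureTheory
open scoped BigOperators Matrix

noncomputable section

namespace NoiseMetrology

variable {H : Type*} [NormedAddCommGroup H] [InnerProductSpace ℂ H] [CompleteSpace H]
variable {R d : ℕ}

/-! ### Partial derivatives, Fisher information -/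

/-- The partial derivative `∂_α f` at `θ` of a vector-valued function of `d` real parameters. -/
def partialDeriv {E : Type*} [NormedAddCommGroup E] [NormedSpace ℝ E]
    (f : (Fin d → ℝ) → E) (θ : Fin d → ℝ) (α : Fin d) : E :=
  lineDeriv ℝ f θ (Pi.single α 1)

/-- The classical Fisher information matrix `∑_j (∂_α p_j) (∂_β p_j) / p_j` of a parametric family
of probability distributions on a finite set of outcomes (outcomes of probability zero do not
contribute). -/
def classicalFisher {ι : Type*} [Fintype ι] (p : (Fin d → ℝ) → ι → ℝ) (θ : Fin d → ℝ) :
    Matrix (Fin d) (Fin d) ℝ :=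
  Matrix.of fun α β => ∑ j,
    partialDeriv (fun θ' => p θ' j) θ α * partialDeriv (fun θ' => p θ' j) θ β / p θ j

/-- The average per parameter, `Tr F / d`. -/
def paramAverage (F : Matrix (Fin d) (Fin d) ℝ) : ℝ := F.trace / d

/-! ### Lindblad dynamics -/

/-- The dissipation matrix `Γ = V Λ V†` with eigenframe `V` and eigenrates `γ`. -/
def dissipationMatrix (V : Matrix (Fin R) (Fin R) ℂ) (γ : Fin R → ℝ) :
    Matrix (Fin R) (Fin R) ℂ :=
  V * Matrix.diagonal (fun k => (γ k : ℂ)) * Vᴴ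

/-- The canonical jump operators `J_k = ∑_i V_{ik} L_i`. -/
def canonicalJump (L : Fin R → H →L[ℂ] H) (V : Matrix (Fin R) (Fin R) ℂ) (k : Fin R) :
    H →L[ℂ] H :=
  ∑ i, V i k • L i

/-- The dissipator `ρ ↦ ∑_{ij} Γ_{ij} (L_i ρ L_j† - ½ {L_j† L_i, ρ})`, as a bounded operator on
`B(H)`. -/
def dissipator (L : Fin R → H →L[ℂ] H) (Γ : Matrix (Fin R) (Fin R) ℂ) :
    (H →L[ℂ] H) →L[ℂ] (H →L[ℂ] H) :=
  ∑ i, ∑ j, Γ i j •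
    (ContinuousLinearMap.mulLeftRight ℂ (H →L[ℂ] H) (L i) (star (L j))
      - (1 / 2 : ℂ) • (ContinuousLinearMap.mul ℂ (H →L[ℂ] H) (star (L j) * L i)
          + (ContinuousLinearMap.mul ℂ (H →L[ℂ] H)).flip (star (L j) * L i)))

/-- The state `ρ(t) = exp(t 𝓓) (|ψ⟩⟨ψ|)` at time `t` under the uncontrolled Lindblad equation
`∂_t ρ = 𝓓(ρ)`, `ρ(0) = |ψ⟩⟨ψ|`. -/
def lindbladState (L : Fin R → H →L[ℂ] H) (Γ : Matrix (Fin R) (Fin R) ℂ) (ψ : H) (t : ℝ) :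
    H →L[ℂ] H :=
  NormedSpace.exp ((t : ℂ) • dissipator L Γ) (InnerProductSpace.rankOne ℂ ψ ψ)

/-! ### Time-ordered exponentials -/

/-- The `n`-th term of the Dyson series,
`∫_{s < u₁ < ⋯ < uₙ < t} K(uₙ) ⋯ K(u₁)`. -/
def dysonTerm (K : ℝ → H →L[ℂ] H) (s : ℝ) : ℕ → ℝ → H →L[ℂ] H
  | 0, _ => 1
  | n + 1, t => ∫ u in s..t, K u * dysonTerm K s n u

/-- The time-ordered exponential `𝒯 exp (∫_s^t K(u) du)`, later times to the left. -/
def timeOrderedExp (K : ℝ → H →L[ℂ] H) (s t : ℝ) : H →L[ℂ] H :=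
  ∑' n, dysonTerm K s n t

/-! ### The collisional purification

The environment is a white-noise bosonic field with `R` modes `e_k(t)`, i.e. the symmetric Fock
space over `L²(ℝ₊) ⊗ ℂ^R`. A vector of `H ⊗ Fock` at time `t` is given by its amplitudes
`Ψ(s₁ k₁, …, sₙ kₙ) ∈ H` for the bath to hold `n` quanta, in the modes `k₁, …, kₙ` at the times
`0 < s₁ < ⋯ < sₙ < t`, so that
`Ψ = ∑_n ∑_{k₁…kₙ} ∫_{0<s₁<⋯<sₙ<t} Ψ(s₁ k₁, …, sₙ kₙ) ⊗ e†_{kₙ}(sₙ) ⋯ e†_{k₁}(s₁) |vac⟩`.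
A configuration of quanta is recorded as a list, the latest one first. -/

/-- Configurations of bath quanta (emission time and mode), the latest one first. -/
abbrev Record (R : ℕ) : Type := List (ℝ × Fin R)

/-- The `n`-quanta part of the inner product of `H ⊗ Fock`,
`∑_{k₁…kₙ} ∫_{0<s₁<⋯<sₙ<t} ⟨f(s₁ k₁, …, sₙ kₙ), g(s₁ k₁, …, sₙ kₙ)⟩ ds₁ ⋯ dsₙ`. -/
def recordInner : ℕ → ℝ → (Record R → H) → (Record R → H) → ℂ
  | 0, _, f, g => inner ℂ (f []) (g [])
  | n + 1, t, f, g => ∑ k, ∫ s in (0 : ℝ)..t,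
      recordInner n s (fun r => f ((s, k) :: r)) (fun r => g ((s, k) :: r))

/-- The inner product of `H ⊗ Fock` at time `t`. -/
def fockInner (t : ℝ) (f g : Record R → H) : ℂ := ∑' n, recordInner n t f g

/-- The generator `-i H_c(t) - ½ ∑_k γ_k J_k† J_k` of the evolution between two emissions. -/
def noJumpGenerator (Hc : ℝ → H →L[ℂ] H) (J : Fin R → H →L[ℂ] H) (γ : Fin R → ℝ) (t : ℝ) :
    H →L[ℂ] H :=
  -(Complex.I • Hc t) - (1 / 2 : ℂ) • ∑ k, (γ k : ℂ) • (star (J k) * J k)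

/-- The canonical collisional purification `Ψ(t) = U(t) (ψ ⊗ vac)`, where
`U(t) = 𝒯 exp (-i ∫_0^t (H_c(s) + ∑_k √γ_k (J_k ⊗ e_k†(s) + h.c.)) ds)`: the amplitude of a
configuration is obtained from `ψ` by applying `-i √γ_k J_k` at each emission in mode `k`, and the
no-jump evolution in between. -/
def collisionalState (Hc : ℝ → H →L[ℂ] H) (J : Fin R → H →L[ℂ] H) (γ : Fin R → ℝ) (ψ : H) :
    ℝ → Record R → H
  | t, [] => timeOrderedExp (noJumpGenerator Hc J γ) 0 t ψ
  | t, (s, k) :: r => timeOrderedExp (noJumpGenerator Hc J γ) s t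
      ((-Complex.I * (Real.sqrt (γ k) : ℂ)) • J k (collisionalState Hc J γ ψ s r))

/-- The quantum Fisher information matrix
`4 Re (⟨∂_α Ψ, ∂_β Ψ⟩ - ⟨∂_α Ψ, Ψ⟩ ⟨Ψ, ∂_β Ψ⟩)` of a family of pure states of `H ⊗ Fock`. -/
def pureQFI (t : ℝ) (Ψ : (Fin d → ℝ) → Record R → H) (θ : Fin d → ℝ) :
    Matrix (Fin d) (Fin d) ℝ :=
  let D : Fin d → Record R → H := fun α r => partialDeriv (fun θ' => Ψ θ' r) θ α
  Matrix.of fun α β =>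
    4 * (fockInner t (D α) (D β) - fockInner t (D α) (Ψ θ) * fockInner t (Ψ θ) (D β)).re

/-- The collisional QFI matrix `F_Q(t; ψ)` at `θ`, for the eigenrates `γ(θ)`. -/
def collisionalQFI (Hc : ℝ → H →L[ℂ] H) (J : Fin R → H →L[ℂ] H)
    (γ : (Fin d → ℝ) → Fin R → ℝ) (θ : Fin d → ℝ) (ψ : H) (t : ℝ) :
    Matrix (Fin d) (Fin d) ℝ :=
  pureQFI t (fun θ' => collisionalState Hc J (γ θ') ψ t) θ

/-- All values of the average QFI rate `F̄_Q(t; ψ) / t`, over times `t > 0` and unit vectors `ψ`. -/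
def qfiRates (Hc : ℝ → H →L[ℂ] H) (J : Fin R → H →L[ℂ] H)
    (γ : (Fin d → ℝ) → Fin R → ℝ) (θ : Fin d → ℝ) : Set ℝ :=
  {r | ∃ t : ℝ, 0 < t ∧ ∃ ψ : H, ‖ψ‖ = 1 ∧
    r = paramAverage (collisionalQFI Hc J γ θ ψ t) / t}

/-- The optimal average QFI rate, `sup_t sup_ψ F̄_Q(t; ψ) / t`. -/
def optimalRate (Hc : ℝ → H →L[ℂ] H) (J : Fin R → H →L[ℂ] H)
    (γ : (Fin d → ℝ) → Fin R → ℝ) (θ : Fin d → ℝ) : ℝ :=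
  sSup (qfiRates Hc J γ θ)

/-- The weights `c_k = ∑_α 4 (∂_α √γ_k)² / d`. -/
def rateWeight (γ : (Fin d → ℝ) → Fin R → ℝ) (θ : Fin d → ℝ) (k : Fin R) : ℝ :=
  (∑ α, 4 * partialDeriv (fun θ' => Real.sqrt (γ θ' k)) θ α ^ 2) / d

/-- The operator `A = ∑_k c_k J_k† J_k`. -/
def rateOperator (J : Fin R → H →L[ℂ] H) (γ : (Fin d → ℝ) → Fin R → ℝ) (θ : Fin d → ℝ) :
    H →L[ℂ] H :=
  ∑ k, (rateWeight γ θ k : ℂ) • (star (J k) * J k)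

/-! ### Rapid prepare-and-measure -/

/-- The normalized jump vectors `j_k = J_k ψ / √μ_k`, `μ_k = ⟨ψ, J_k† J_k ψ⟩`. -/
def jumpVector (J : Fin R → H →L[ℂ] H) (ψ : H) (k : Fin R) : H :=
  ((1 / Real.sqrt (inner ℂ ψ ((star (J k) * J k) ψ)).re : ℝ) : ℂ) • J k ψ

/-- `ψ` admits a distinguishable jump basis (equivalently, the projective jump POVM
`{|ψ⟩⟨ψ|, |j_1⟩⟨j_1|, …, |j_R⟩⟨j_R|, Π_⊥}` makes sense): the jump vectors are orthonormal, and
orthogonal to `ψ`. -/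
def HasDistinguishableJumps (J : Fin R → H →L[ℂ] H) (ψ : H) : Prop :=
  Orthonormal ℂ (jumpVector J ψ) ∧ ∀ k, inner ℂ ψ (jumpVector J ψ k) = 0

/-- The Born probabilities of the jump POVM in a state `ρ` of unit trace: outcome `some (some k)`
is `|j_k⟩⟨j_k|`, outcome `some none` is `|ψ⟩⟨ψ|`, and outcome `none` is
`Π_⊥ = 1 - |ψ⟩⟨ψ| - ∑_k |j_k⟩⟨j_k|`. -/
def jumpProb (J : Fin R → H →L[ℂ] H) (ψ : H) (ρ : H →L[ℂ] H) : Option (Option (Fin R)) → ℝ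
  | some (some k) => (inner ℂ (jumpVector J ψ k) (ρ (jumpVector J ψ k))).re
  | some none => (inner ℂ ψ (ρ ψ)).re
  | none => 1 - (inner ℂ ψ (ρ ψ)).re
      - ∑ k, (inner ℂ (jumpVector J ψ k) (ρ (jumpVector J ψ k))).re

/-- The Fisher information matrix of one shot of the rapid prepare-and-measure protocol: prepare
`ψ`, evolve for a time `δt` without control, measure the jump POVM. -/
def rpmFisher (L : Fin R → H →L[ℂ] H) (V : Matrix (Fin R) (Fin R) ℂ)
    (γ : (Fin d → ℝ) → Fin R → ℝ) (θ : Fin d → ℝ) (ψ : H) (δt : ℝ) :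
    Matrix (Fin d) (Fin d) ℝ :=
  classicalFisher (fun θ' => jumpProb (canonicalJump L V) ψ
    (lindbladState L (dissipationMatrix V (γ θ')) ψ δt)) θ

end NoiseMetrology

end

/-! Fix one parameter, let `Ψ'` be the derivative of `Ψ` and `g_k` that of `√γ_k`. The no-jump
generator `K` and the emissions `C_k = -i √γ_k J_k` satisfy `K† + K + ∑ C_k† C_k = 0`, and because
only the eigenrates vary, their derivatives satisfy `K' + ∑ C_k† C'_k = 0`. Hence `⟨Ψ, Ψ⟩` and `⟨Ψ,
Ψ'⟩` are constant in time, the latter being zero, while `‖Ψ'‖²` grows at the rate `∑ g_k² ⟨J_k†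
J_k⟩`. Averaging over the parameters gives the exact formula `F̄_Q(t) = ∫_0^t ⟨A⟩_s ds`
(`paramAverage_collisionalQFI`). The QFI rate is thus a time average of `⟨A⟩`: it is at most `‖A‖`
and tends to `⟨ψ, A ψ⟩` at short times, so its supremum is `‖A‖` (`isLUB_qfiRates`), which is the
top of the spectrum since `A ≥ 0`.

Since `H_c` is only locally integrable, differential equations are kept in integral form
(`IsPrimitive`). The pair `(Ψ, Ψ')` is treated as a single record on `H × H`, driven by lower
triangular block operators, so one evolution equation, `isPrimitive_jumpState_conj`, yields all
three inner products.

For rapid prepare-and-measure, outcome `j_k` has probability `γ_k μ_k δt` to first order and so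
carries information `4 g_k² μ_k` per unit time; these add up to `⟨ψ, A ψ⟩`. The outcome `ψ` has
probability near one and contributes `O(δt)` to the rate. The delicate outcome is `Π_⊥`, where both
`p` and `p'` vanish to first order. There `p ≥ 0` along the rates `(√γ_k + x g_k)²`, for every real
`x`, forces `p'² = O(δt² p)` (`tendsto_fisher_of_apply_eq_zero`). This rests on positivity of the
Lindblad semigroup (`exp_lindbladAdjoint_nonneg`). -/

namespace NoiseMetrology

open Set intervalIntegral

/-! ### Primitives of locally integrable functions -/

/-- `f` is a primitive of the locally integrable function `f'`. -/
structure IsPrimitive {E : Type*} [NormedAddCommGroup E] [NormedSpace ℝ E] (f f' : ℝ → E) :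
    Prop where
  intervalIntegrable : ∀ a b, IntervalIntegrable f' volume a b
  sub_eq : ∀ a b, f b - f a = ∫ u in a..b, f' u

section Primitive

variable {𝕜 : Type*} [RCLike 𝕜]
  {E : Type*} [NormedAddCommGroup E] [NormedSpace ℝ E] [NormedSpace 𝕜 E] [CompleteSpace E]
  {F : Type*} [NormedAddCommGroup F] [NormedSpace ℝ F] [NormedSpace 𝕜 F] [CompleteSpace F]
  {G : Type*} [NormedAddCommGroup G] [NormedSpace ℝ G] [NormedSpace 𝕜 G] [CompleteSpace G]

omit [CompleteSpace E] in
theorem IsPrimitive.eq_add {f f' : ℝ → E} (h : IsPrimitive f f') (a b : ℝ) :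
    f b = f a + ∫ u in a..b, f' u := by
  rw [← h.sub_eq a b]; abel

omit [CompleteSpace E] in
theorem IsPrimitive.continuous {f f' : ℝ → E} (h : IsPrimitive f f') : Continuous f := by
  have : f = fun b => f 0 + ∫ u in (0 : ℝ)..b, f' u := funext fun b => h.eq_add 0 b
  rw [this]
  exact continuous_const.add (continuous_primitive h.intervalIntegrable 0)

omit [CompleteSpace E] in
theorem IsPrimitive.of_forall_eq_add {f f' : ℝ → E} (s : ℝ)
    (hi : ∀ a b, IntervalIntegrable f' volume a b) (h : ∀ t, f t = f s + ∫ u in s..t, f' u) :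
    IsPrimitive f f' where
  intervalIntegrable := hi
  sub_eq a b := by
    rw [h a, h b, add_sub_add_left_eq_sub, integral_interval_sub_left (hi _ _) (hi _ _)]

omit [CompleteSpace E] in
theorem isPrimitive_integral {f' : ℝ → E} (hi : ∀ a b, IntervalIntegrable f' volume a b) (s : ℝ) :
    IsPrimitive (fun t => ∫ u in s..t, f' u) f' :=
  .of_forall_eq_add s hi fun t => by simp

omit [CompleteSpace E] in
theorem IsPrimitive.add {f f' g g' : ℝ → E} (hf : IsPrimitive f f') (hg : IsPrimitive g g') :
    IsPrimitive (fun t => f t + g t) (fun t => f' t + g' t) where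
  intervalIntegrable a b := (hf.intervalIntegrable a b).add (hg.intervalIntegrable a b)
  sub_eq a b := by
    rw [intervalIntegral.integral_add (hf.intervalIntegrable a b) (hg.intervalIntegrable a b),
      ← hf.sub_eq, ← hg.sub_eq]
    abel

omit [CompleteSpace E] in
theorem IsPrimitive.sub {f f' g g' : ℝ → E} (hf : IsPrimitive f f') (hg : IsPrimitive g g') :
    IsPrimitive (fun t => f t - g t) (fun t => f' t - g' t) where
  intervalIntegrable a b := (hf.intervalIntegrable a b).sub (hg.intervalIntegrable a b)
  sub_eq a b := by
    rw [intervalIntegral.integral_sub (hf.intervalIntegrable a b) (hg.intervalIntegrable a b),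
      ← hf.sub_eq, ← hg.sub_eq]
    abel

theorem IsPrimitive.clm {f f' : ℝ → E} (hf : IsPrimitive f f') (L : E →L[𝕜] F) :
    IsPrimitive (fun t => L (f t)) (fun t => L (f' t)) where
  intervalIntegrable a b :=
    ⟨L.integrable_comp (hf.intervalIntegrable a b).1, L.integrable_comp (hf.intervalIntegrable a b).2⟩
  sub_eq a b := by
    rw [L.intervalIntegral_comp_comm (hf.intervalIntegrable a b), ← hf.sub_eq, map_sub]

omit [NormedSpace ℝ E] [CompleteSpace E] [NormedSpace ℝ F] [CompleteSpace F]
  [NormedSpace ℝ G] [CompleteSpace G] in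
/-- A bounded bilinear map takes an integrable and a continuous function to an integrable one. -/
theorem intervalIntegrable_bilin (B : E →L[𝕜] F →L[𝕜] G) {f : ℝ → E} {g : ℝ → F} {a b : ℝ}
    (hf : IntervalIntegrable f volume a b) (hg : Continuous g) :
    IntervalIntegrable (fun u => B (f u) (g u)) volume a b := by
  obtain ⟨C, hC⟩ := (isCompact_uIcc (a := a) (b := b)).exists_bound_of_continuousOn hg.continuousOn
  rw [intervalIntegrable_iff] at hf ⊢
  refine Integrable.mono' ((hf.norm.const_mul (‖B‖ * C))) ?_ ?_
  · exact Continuous.comp_aestronglyMeasurable₂ (g := fun x y => B x y)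
      (show Continuous (fun p : E × F => B p.1 p.2) by fun_prop) hf.1 hg.aestronglyMeasurable
  · filter_upwards [ae_restrict_mem measurableSet_uIoc] with u hu
    calc ‖B (f u) (g u)‖ ≤ ‖B‖ * ‖f u‖ * ‖g u‖ := B.le_opNorm₂ _ _
      _ ≤ ‖B‖ * ‖f u‖ * C := by gcongr; exact hC u (uIoc_subset_uIcc hu)
      _ = ‖B‖ * C * ‖f u‖ := by ring

/-- Fubini on the square `(a, b]²`: the two terms are the integrals of `B (f' u) (g' v)` over the
triangles `v ≤ u` and `u < v`. No pointwise differentiability is needed. -/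
theorem integral_bilin_primitive_of_le (B : E →L[𝕜] F →L[𝕜] G) {f f' : ℝ → E} {g g' : ℝ → F}
    (hf : IsPrimitive f f') (hg : IsPrimitive g g') {a b : ℝ} (hab : a ≤ b) :
    (∫ u in a..b, B (f' u) (g u - g a)) + ∫ u in a..b, B (f u - f a) (g' u) =
      B (f b - f a) (g b - g a) := by
  set μ : Measure ℝ := volume.restrict (Ioc a b) with hμ
  have hf' : Integrable f' μ := (hf.intervalIntegrable a b).1
  have hg' : Integrable g' μ := (hg.intervalIntegrable a b).1
  have hi : Integrable (fun z : ℝ × ℝ => B (f' z.1) (g' z.2)) (μ.prod μ) :=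
    hf'.op_fst_snd (by fun_prop) ⟨‖B‖, B.le_opNorm₂⟩ hg'
  have hS : MeasurableSet {z : ℝ × ℝ | z.2 ≤ z.1} := measurableSet_le measurable_snd measurable_fst
  rw [integral_of_le hab, integral_of_le hab]
  have h1 : ∫ u, B (f' u) (g u - g a) ∂μ =
      ∫ z, {z : ℝ × ℝ | z.2 ≤ z.1}.indicator (fun z => B (f' z.1) (g' z.2)) z ∂μ.prod μ := by
    rw [integral_prod _ (hi.indicator hS)]
    refine integral_congr_ae ?_
    filter_upwards [ae_restrict_mem measurableSet_Ioc] with u hu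
    have : (fun v => {z : ℝ × ℝ | z.2 ≤ z.1}.indicator (fun z => B (f' z.1) (g' z.2)) (u, v)) =
        fun v => (Iic u).indicator (fun v => B (f' u) (g' v)) v := by
      ext v; simp [indicator]
    rw [this, MeasureTheory.integral_indicator measurableSet_Iic, hμ,
      Measure.restrict_restrict measurableSet_Iic,
      show Iic u ∩ Ioc a b = Ioc a u by ext x; simp only [mem_inter_iff, mem_Iic, mem_Ioc]; grind,
      hg.sub_eq, integral_of_le hu.1.le,
      ← ContinuousLinearMap.integral_comp_comm _ (hg.intervalIntegrable a u).1]
  have h2 : ∫ u, B (f u - f a) (g' u) ∂μ =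
      ∫ z, {z : ℝ × ℝ | z.2 ≤ z.1}ᶜ.indicator (fun z => B (f' z.1) (g' z.2)) z ∂μ.prod μ := by
    rw [integral_prod_symm _ (hi.indicator hS.compl)]
    refine integral_congr_ae ?_
    filter_upwards [ae_restrict_mem measurableSet_Ioc] with u hu
    have : (fun v => {z : ℝ × ℝ | z.2 ≤ z.1}ᶜ.indicator (fun z => B (f' z.1) (g' z.2)) (v, u)) =
        fun v => (Iio u).indicator (fun v => B.flip (g' u) (f' v)) v := by
      ext v; simp [indicator]
    rw [this, MeasureTheory.integral_indicator measurableSet_Iio, hμ,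
      Measure.restrict_restrict measurableSet_Iio,
      show Iio u ∩ Ioc a b = Ioo a u by ext x; simp only [mem_inter_iff, mem_Iio, mem_Ioc, mem_Ioo]; grind,
      ← integral_Ioc_eq_integral_Ioo,
      hf.sub_eq, integral_of_le hu.1.le,
      ContinuousLinearMap.integral_comp_comm _ (hf.intervalIntegrable a u).1]
    simp
  rw [h1, h2, ← MeasureTheory.integral_add (hi.indicator hS) (hi.indicator hS.compl)]
  simp only [indicator_self_add_compl_apply]
  rw [integral_prod_bilin B hf' hg', hf.sub_eq, hg.sub_eq, integral_of_le hab, integral_of_le hab]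

/-- The product rule for primitives of locally integrable functions. -/
theorem IsPrimitive.bilin (B : E →L[𝕜] F →L[𝕜] G) {f f' : ℝ → E} {g g' : ℝ → F}
    (hf : IsPrimitive f f') (hg : IsPrimitive g g') :
    IsPrimitive (fun t => B (f t) (g t)) (fun t => B (f' t) (g t) + B (f t) (g' t)) := by
  have i1 : ∀ a b, IntervalIntegrable (fun u => B (f' u) (g u)) volume a b := fun a b =>
    intervalIntegrable_bilin B (hf.intervalIntegrable a b) hg.continuous
  have i2 : ∀ a b, IntervalIntegrable (fun u => B (f u) (g' u)) volume a b := fun a b =>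
    intervalIntegrable_bilin B.flip (hg.intervalIntegrable a b) hf.continuous
  have key : ∀ a b, a ≤ b →
      B (f b) (g b) - B (f a) (g a) = ∫ u in a..b, (B (f' u) (g u) + B (f u) (g' u)) := by
    intro a b hab
    have h := integral_bilin_primitive_of_le B hf hg hab
    have e1 : ∫ u in a..b, B (f' u) (g u - g a) =
        (∫ u in a..b, B (f' u) (g u)) - B (f b - f a) (g a) := by
      simp only [map_sub]
      rw [integral_sub (i1 a b)
        (intervalIntegrable_bilin B (hf.intervalIntegrable a b) continuous_const)]
      congr 1
      rw [show (fun u => B (f' u) (g a)) = fun u => B.flip (g a) (f' u) from rfl,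
        ContinuousLinearMap.intervalIntegral_comp_comm _ (hf.intervalIntegrable a b), ← hf.sub_eq]
      simp
    have e2 : ∫ u in a..b, B (f u - f a) (g' u) =
        (∫ u in a..b, B (f u) (g' u)) - B (f a) (g b - g a) := by
      simp only [map_sub, sub_apply]
      rw [integral_sub (i2 a b) (by
        simpa using intervalIntegrable_bilin B.flip (hg.intervalIntegrable a b)
          (continuous_const (y := f a)))]
      congr 1
      rw [ContinuousLinearMap.intervalIntegral_comp_comm _ (hg.intervalIntegrable a b), ← hg.sub_eq,
        map_sub]
    rw [e1, e2] at h
    rw [integral_add (i1 a b) (i2 a b)]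
    simp only [map_sub, sub_apply] at h ⊢
    rw [sub_add_sub_comm, sub_eq_iff_eq_add] at h
    rw [h]; abel
  refine ⟨fun a b => (i1 a b).add (i2 a b), fun a b => ?_⟩
  rcases le_total a b with hab | hab
  · exact key a b hab
  · rw [integral_symm, ← key b a hab]; abel

end Primitive

/-! ### Linear differential equations with locally integrable coefficients -/

theorem IsPrimitive.pow {f f' : ℝ → ℝ} (hf : IsPrimitive f f') (n : ℕ) :
    IsPrimitive (fun t => f t ^ (n + 1)) (fun t => (n + 1) * (f' t * f t ^ n)) := by
  induction n with
  | zero => simpa using hf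
  | succ n ih =>
    have h := ih.bilin (ContinuousLinearMap.mul ℝ ℝ) hf
    simp only [ContinuousLinearMap.mul_apply'] at h
    convert! h using 2
    push_cast; ring

/-- The primitive of `κ ≥ 0` based at `s` has constant sign on each side of `s`, so for `t < s` the
inner absolute value only costs a factor `(-1)^n`. -/
theorem abs_integral_mul_abs_primitive_pow {κ : ℝ → ℝ}
    (hκ : ∀ a b, IntervalIntegrable κ volume a b) (hκ0 : ∀ u, 0 ≤ κ u) (n : ℕ) (s t : ℝ) :
    |∫ u in s..t, κ u * |∫ v in s..u, κ v| ^ n| = |∫ u in s..t, κ u| ^ (n + 1) / (n + 1) := by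
  have hP := (isPrimitive_integral hκ s).pow n
  have h := hP.sub_eq s t
  simp only [integral_same, intervalIntegral.integral_const_mul] at h
  have hn : (n + 1 : ℝ) ≠ 0 := by positivity
  have h' : |∫ u in s..t, κ u * (∫ v in s..u, κ v) ^ n| =
      |∫ u in s..t, κ u| ^ (n + 1) / (n + 1) := by
    have h1 := congrArg abs h
    rw [zero_pow n.succ_ne_zero, sub_zero, abs_pow, abs_mul,
      abs_of_nonneg (show (0 : ℝ) ≤ n + 1 by positivity)] at h1
    rw [eq_div_iff hn, h1, mul_comm]
  rw [← h']
  rcases le_total s t with hst | hst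
  · congr 1
    refine integral_congr fun u hu => ?_
    rw [uIcc_of_le hst] at hu
    rw [abs_of_nonneg (integral_nonneg hu.1 fun v _ => hκ0 v)]
  · have : ∀ u ∈ uIcc s t, κ u * |∫ v in s..u, κ v| ^ n =
        (-1) ^ n * (κ u * (∫ v in s..u, κ v) ^ n) := by
      intro u hu
      rw [uIcc_of_ge hst] at hu
      rw [abs_of_nonpos, neg_pow]
      · ring
      · rw [integral_symm]
        exact neg_nonpos.2 (integral_nonneg hu.2 fun v _ => hκ0 v)
    rw [integral_congr this, intervalIntegral.integral_const_mul, abs_mul]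
    simp

section LinearODE

variable {𝕜 : Type*} [RCLike 𝕜]
  {F : Type*} [NormedAddCommGroup F] [NormedSpace ℝ F] [NormedSpace 𝕜 F] [CompleteSpace F]
  {A : ℝ → F →L[𝕜] F}

omit [CompleteSpace F] in
-- One Picard iteration advances the factorial bound by one step.
theorem norm_integral_le_pow_div_factorial (hA : ∀ a b, IntervalIntegrable A volume a b)
    {f : ℝ → F} {c : ℝ} (hc : 0 ≤ c) {n : ℕ} {s t : ℝ}
    (hf : ∀ u ∈ uIcc s t, ‖f u‖ ≤ c * (|∫ v in s..u, ‖A v‖| ^ n / n.factorial)) :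
    ‖∫ u in s..t, A u (f u)‖ ≤ c * (|∫ v in s..t, ‖A v‖| ^ (n + 1) / (n + 1).factorial) := by
  have hκ : ∀ a b, IntervalIntegrable (fun u => ‖A u‖) volume a b := fun a b => (hA a b).norm
  have hP : Continuous fun u => |∫ v in s..u, ‖A v‖| ^ n :=
    ((continuous_primitive hκ s).abs).pow n
  have hi : IntervalIntegrable (fun u => ‖A u‖ * |∫ v in s..u, ‖A v‖| ^ n) volume s t :=
    (hκ s t).mul_continuousOn hP.continuousOn
  calc ‖∫ u in s..t, A u (f u)‖
      ≤ |∫ u in s..t, (c / n.factorial) * (‖A u‖ * |∫ v in s..u, ‖A v‖| ^ n)| := by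
        refine norm_integral_le_abs_of_norm_le ?_ (hi.const_mul _)
        filter_upwards [ae_restrict_mem measurableSet_uIoc] with u hu
        calc ‖A u (f u)‖ ≤ ‖A u‖ * ‖f u‖ := (A u).le_opNorm _
          _ ≤ ‖A u‖ * (c * (|∫ v in s..u, ‖A v‖| ^ n / n.factorial)) := by
            gcongr; exact hf u (uIoc_subset_uIcc hu)
          _ = _ := by ring
    _ = c * (|∫ v in s..t, ‖A v‖| ^ (n + 1) / (n + 1).factorial) := by
        rw [intervalIntegral.integral_const_mul, abs_mul,
          abs_integral_mul_abs_primitive_pow hκ (fun _ => norm_nonneg _),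
          abs_of_nonneg (by positivity), Nat.factorial_succ]
        push_cast
        field_simp

omit [CompleteSpace F] in
-- Iterating the integral equation bounds `f` by `M |∫‖A‖|^n / n!` for every `n`, which tends to
-- zero.
theorem IsPrimitive.eq_zero_of_linear (hA : ∀ a b, IntervalIntegrable A volume a b) {f : ℝ → F}
    (hf : IsPrimitive f fun u => A u (f u)) {s : ℝ} (h0 : f s = 0) (t : ℝ) : f t = 0 := by
  obtain ⟨M, hM⟩ := (isCompact_uIcc (a := s) (b := t)).exists_bound_of_continuousOn
    hf.continuous.continuousOn
  have hM0 : 0 ≤ M := (norm_nonneg _).trans (hM s left_mem_uIcc)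
  have key : ∀ n : ℕ, ∀ u ∈ uIcc s t, ‖f u‖ ≤ M * (|∫ v in s..u, ‖A v‖| ^ n / n.factorial) := by
    intro n
    induction n with
    | zero => intro u hu; simpa using hM u hu
    | succ n ih =>
      intro u hu
      rw [hf.eq_add s u, h0, zero_add]
      exact norm_integral_le_pow_div_factorial hA hM0
        fun v hv => ih v (uIcc_subset_uIcc_left hu hv)
  have lim := (FloorSemiring.tendsto_pow_div_factorial_atTop |∫ v in s..t, ‖A v‖|).const_mul M
  rw [mul_zero] at lim
  exact norm_le_zero_iff.1 (ge_of_tendsto' lim fun n => key n t right_mem_uIcc)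

/-- The iterates `x_{n+1}(t) = ∫_s^t A x_n`, `x_0 = c`, of a linear differential equation. -/
structure IsDysonSequence (A : ℝ → F →L[𝕜] F) (s : ℝ) (c : F) (x : ℕ → ℝ → F) : Prop where
  intervalIntegrable : ∀ a b, IntervalIntegrable A volume a b
  zero : ∀ t, x 0 t = c
  succ : ∀ n t, x (n + 1) t = ∫ u in s..t, A u (x n u)

namespace IsDysonSequence

variable {s : ℝ} {c : F} {x : ℕ → ℝ → F}

omit [CompleteSpace F] in
theorem norm_le (h : IsDysonSequence A s c x) (n : ℕ) (t : ℝ) :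
    ‖x n t‖ ≤ ‖c‖ * (|∫ v in s..t, ‖A v‖| ^ n / n.factorial) := by
  induction n generalizing t with
  | zero => simp [h.zero]
  | succ n ih =>
    rw [h.succ]
    exact norm_integral_le_pow_div_factorial h.intervalIntegrable (norm_nonneg _) fun u _ => ih u

omit [CompleteSpace F] in
theorem continuous (h : IsDysonSequence A s c x) (n : ℕ) : Continuous (x n) := by
  induction n with
  | zero => rw [funext h.zero]; exact continuous_const
  | succ n ih =>
    rw [funext (h.succ n)]
    exact continuous_primitive (fun a b =>
      intervalIntegrable_bilin (ContinuousLinearMap.id 𝕜 (F →L[𝕜] F)) (h.intervalIntegrable a b) ih) s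

omit [CompleteSpace F] in
theorem summable_norm (h : IsDysonSequence A s c x) (t : ℝ) : Summable fun n => ‖x n t‖ :=
  .of_nonneg_of_le (fun _ => norm_nonneg _) (fun n => h.norm_le n t)
    ((Real.summable_pow_div_factorial _).mul_left _)

theorem summable (h : IsDysonSequence A s c x) (t : ℝ) : Summable fun n => x n t :=
  (h.summable_norm t).of_norm

omit [CompleteSpace F] in
theorem norm_tsum_le (h : IsDysonSequence A s c x) (t : ℝ) :
    ‖∑' n, x n t‖ ≤ ‖c‖ * Real.exp |∫ v in s..t, ‖A v‖| := by
  have hs : HasSum (fun n : ℕ => |∫ v in s..t, ‖A v‖| ^ n / n.factorial)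
      (Real.exp |∫ v in s..t, ‖A v‖|) := by
    rw [Real.exp_eq_exp_ℝ]
    exact NormedSpace.expSeries_div_hasSum_exp _
  exact tsum_of_norm_bounded (hs.mul_left ‖c‖) fun n => h.norm_le n t

omit [CompleteSpace F] in
theorem tsum_self (h : IsDysonSequence A s c x) : ∑' n, x n s = c := by
  rw [tsum_eq_single 0, h.zero]
  rintro (_ | n) hn
  · exact absurd rfl hn
  · rw [h.succ, integral_same]

theorem isPrimitive_tsum (h : IsDysonSequence A s c x) :
    IsPrimitive (fun t => ∑' n, x n t) (fun u => A u (∑' n, x n u)) := by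
  have hκ : ∀ a b, IntervalIntegrable (fun u => ‖A u‖) volume a b :=
    fun a b => (h.intervalIntegrable a b).norm
  have hle : ∀ t, ∀ u ∈ uIcc s t, |∫ v in s..u, ‖A v‖| ≤ |∫ v in s..t, ‖A v‖| := by
    intro t u hu
    refine abs_integral_mono_interval (uIoc_subset_uIoc_of_uIcc_subset_uIcc ?_) ?_ (hκ s t)
    · exact uIcc_subset_uIcc_left hu
    · exact .of_forall fun _ => norm_nonneg _
  have hb : ∀ t, ∀ u ∈ uIcc s t, ∀ n,
      ‖x n u‖ ≤ ‖c‖ * (|∫ v in s..t, ‖A v‖| ^ n / n.factorial) := fun t u hu n =>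
    (h.norm_le n u).trans (by
      have := pow_le_pow_left₀ (abs_nonneg _) (hle t u hu) n
      gcongr)
  have hcont : Continuous fun t => ∑' n, x n t := by
    have hcs : ∀ t, ContinuousOn (fun t => ∑' n, x n t) (uIcc s t) := fun t =>
      continuousOn_tsum (fun n => (h.continuous n).continuousOn)
        ((Real.summable_pow_div_factorial |∫ v in s..t, ‖A v‖|).mul_left ‖c‖)
        fun n u hu => hb t u hu n
    rw [continuous_iff_continuousAt]
    intro t
    -- Uniform convergence is available only on segments with endpoint `s`; two of them, one on each
    -- side of `s`, are glued into a neighbourhood of `t`.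
    rcases le_total s t with hst | hst
    · have h1 := hcs (t + 1)
      have h2 := hcs (s - 1)
      rw [uIcc_of_le (by linarith)] at h1
      rw [uIcc_of_ge (by linarith)] at h2
      have h3 := h2.union_of_isClosed h1 isClosed_Icc isClosed_Icc
      rw [Icc_union_Icc_eq_Icc (by linarith) (by linarith)] at h3
      exact h3.continuousAt (Icc_mem_nhds (by linarith) (by linarith))
    · have h1 := hcs (t - 1)
      have h2 := hcs (s + 1)
      rw [uIcc_of_ge (by linarith)] at h1
      rw [uIcc_of_le (by linarith)] at h2
      have h3 := h1.union_of_isClosed h2 isClosed_Icc isClosed_Icc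
      rw [Icc_union_Icc_eq_Icc (by linarith) (by linarith)] at h3
      exact h3.continuousAt (Icc_mem_nhds (by linarith) (by linarith))
  have hi : ∀ a b, IntervalIntegrable (fun u => A u (∑' n, x n u)) volume a b := fun a b =>
    intervalIntegrable_bilin (ContinuousLinearMap.id 𝕜 (F →L[𝕜] F)) (h.intervalIntegrable a b) hcont
  refine .of_forall_eq_add s hi fun t => ?_
  have hsum : HasSum (fun n => ∫ u in s..t, A u (x n u)) (∫ u in s..t, A u (∑' n, x n u)) := by
    refine hasSum_integral_of_dominated_convergence
      (fun n u => ‖A u‖ * (‖c‖ * (|∫ v in s..t, ‖A v‖| ^ n / n.factorial))) (fun n => ?_)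
      (fun n => .of_forall fun u hu => ?_) (.of_forall fun u _ => ?_) ?_ (.of_forall fun u _ => ?_)
    · exact (intervalIntegrable_bilin (ContinuousLinearMap.id 𝕜 (F →L[𝕜] F))
        (h.intervalIntegrable s t) (h.continuous n)).def'.1
    · exact ((A u).le_opNorm _).trans (by gcongr; exact hb t u (uIoc_subset_uIcc hu) n)
    · exact ((Real.summable_pow_div_factorial _).mul_left _).mul_left _
    · simp_rw [tsum_mul_left]
      exact (hκ s t).mul_const _
    · exact (A u).hasSum (h.summable u).hasSum
  rw [h.tsum_self, ← hsum.tsum_eq, (h.summable t).tsum_eq_zero_add, h.zero]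
  simp only [h.succ]

end IsDysonSequence

end LinearODE

/-! ### Time-ordered exponentials of locally integrable generators -/

section TimeOrderedExp

variable {H : Type*} [NormedAddCommGroup H] [InnerProductSpace ℂ H] [CompleteSpace H]
  {K : ℝ → H →L[ℂ] H}

/-- The coefficient acts on `B(H)` by left multiplication, so the linear theory is applied with
values in `B(H)`. -/
theorem isDysonSequence_dysonTerm (hK : ∀ a b, IntervalIntegrable K volume a b) (s : ℝ) :
    IsDysonSequence (fun u => ContinuousLinearMap.mul ℂ (H →L[ℂ] H) (K u)) s 1 (dysonTerm K s) where
  intervalIntegrable a b :=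
    ⟨(ContinuousLinearMap.mul ℂ (H →L[ℂ] H)).integrable_comp (hK a b).1,
      (ContinuousLinearMap.mul ℂ (H →L[ℂ] H)).integrable_comp (hK a b).2⟩
  zero _ := rfl
  succ _ _ := rfl

theorem isPrimitive_timeOrderedExp (hK : ∀ a b, IntervalIntegrable K volume a b) (s : ℝ) :
    IsPrimitive (timeOrderedExp K s) (fun u => K u * timeOrderedExp K s u) :=
  (isDysonSequence_dysonTerm hK s).isPrimitive_tsum

theorem timeOrderedExp_self (hK : ∀ a b, IntervalIntegrable K volume a b) (s : ℝ) :
    timeOrderedExp K s s = 1 :=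
  (isDysonSequence_dysonTerm hK s).tsum_self

theorem continuous_timeOrderedExp (hK : ∀ a b, IntervalIntegrable K volume a b) (s : ℝ) :
    Continuous (timeOrderedExp K s) :=
  (isPrimitive_timeOrderedExp hK s).continuous

theorem norm_timeOrderedExp_le (hK : ∀ a b, IntervalIntegrable K volume a b) {κ : ℝ → ℝ}
    (hκ : ∀ a b, IntervalIntegrable κ volume a b) (hKκ : ∀ u, ‖K u‖ ≤ κ u) (s t : ℝ) :
    ‖timeOrderedExp K s t‖ ≤ Real.exp |∫ v in s..t, κ v| := by
  refine ((isDysonSequence_dysonTerm hK s).norm_tsum_le t).trans ?_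
  have h1 : ‖(1 : H →L[ℂ] H)‖ ≤ 1 := ContinuousLinearMap.norm_id_le
  have h2 : |∫ v in s..t, ‖ContinuousLinearMap.mul ℂ (H →L[ℂ] H) (K v)‖| ≤ |∫ v in s..t, κ v| := by
    refine norm_integral_le_abs_of_norm_le
      (f := fun v => ‖ContinuousLinearMap.mul ℂ (H →L[ℂ] H) (K v)‖) (.of_forall fun u => ?_) (hκ s t)
    rw [norm_norm]
    exact (ContinuousLinearMap.opNorm_mul_apply_le ℂ _ (K u)).trans (hKκ u)
  calc _ ≤ 1 * Real.exp |∫ v in s..t, κ v| := by gcongr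
    _ = _ := one_mul _

/-- Solutions of `X' = K X` are determined by their value at a time `s`. -/
theorem IsPrimitive.eq_timeOrderedExp_mul (hK : ∀ a b, IntervalIntegrable K volume a b)
    {X : ℝ → H →L[ℂ] H} (hX : IsPrimitive X fun u => K u * X u) (s t : ℝ) :
    X t = timeOrderedExp K s t * X s := by
  have h1 := (isPrimitive_timeOrderedExp hK s).clm
    ((ContinuousLinearMap.mul ℂ (H →L[ℂ] H)).flip (X s))
  have h2 := hX.sub h1
  simp only [ContinuousLinearMap.flip_apply, ContinuousLinearMap.mul_apply', mul_assoc,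
    ← mul_sub] at h2
  have := IsPrimitive.eq_zero_of_linear (isDysonSequence_dysonTerm hK s).intervalIntegrable h2
    (s := s) (by simp [timeOrderedExp_self hK]) t
  exact sub_eq_zero.1 this

/-- The times are in any order: integrals are signed, so this also makes the backward propagator an
inverse of the forward one. -/
theorem timeOrderedExp_mul (hK : ∀ a b, IntervalIntegrable K volume a b) (r s t : ℝ) :
    timeOrderedExp K s t * timeOrderedExp K r s = timeOrderedExp K r t :=
  ((isPrimitive_timeOrderedExp hK r).eq_timeOrderedExp_mul hK s t).symm

theorem timeOrderedExp_mul_swap (hK : ∀ a b, IntervalIntegrable K volume a b) (s t : ℝ) :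
    timeOrderedExp K s t * timeOrderedExp K t s = 1 := by
  rw [timeOrderedExp_mul hK, timeOrderedExp_self hK]

/-- Exchanging the two times inverts the propagator, and inversion is continuous on units. -/
theorem continuous_timeOrderedExp_left (hK : ∀ a b, IntervalIntegrable K volume a b) (t : ℝ) :
    Continuous fun s => timeOrderedExp K s t := by
  let U : ℝ → (H →L[ℂ] H)ˣ := fun s =>
    ⟨timeOrderedExp K t s, timeOrderedExp K s t, timeOrderedExp_mul_swap hK t s,
      timeOrderedExp_mul_swap hK s t⟩
  have : (fun s => timeOrderedExp K s t) = fun s => Ring.inverse (timeOrderedExp K t s) :=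
    funext fun s => (Ring.inverse_unit (U s)).symm
  rw [this, continuous_iff_continuousAt]
  intro s
  exact (NormedRing.inverse_continuousAt (U s)).comp (f := timeOrderedExp K t)
    (continuous_timeOrderedExp hK t).continuousAt

/-! ### Dependence on a constant perturbation of the generator -/

theorem intervalIntegrable_add_const (hK : ∀ a b, IntervalIntegrable K volume a b)
    (P : H →L[ℂ] H) (a b : ℝ) : IntervalIntegrable (fun u => K u + P) volume a b :=
  (hK a b).add intervalIntegrable_const

/-- Variation of constants. -/
theorem timeOrderedExp_add_const (hK : ∀ a b, IntervalIntegrable K volume a b)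
    (P : H →L[ℂ] H) (s t : ℝ) :
    timeOrderedExp (fun u => K u + P) s t = timeOrderedExp K s t + timeOrderedExp K 0 t *
      ∫ u in s..t, timeOrderedExp K u 0 * P * timeOrderedExp (fun u => K u + P) s u := by
  set E := timeOrderedExp (fun u => K u + P) s with hE
  have hKP := intervalIntegrable_add_const hK P
  have hEc : Continuous E := continuous_timeOrderedExp hKP s
  have hc : Continuous fun u => timeOrderedExp K u 0 * P * E u :=
    ((continuous_timeOrderedExp_left hK 0).mul continuous_const).mul hEc
  -- By the product rule the difference of the two sides solves `Y' = K Y` and vanishes at `s`.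
  have h1 := (isPrimitive_timeOrderedExp hK 0).bilin (ContinuousLinearMap.mul ℂ (H →L[ℂ] H))
    (isPrimitive_integral (fun a b => hc.intervalIntegrable a b) s)
  have h2 := ((isPrimitive_timeOrderedExp hKP s).sub (isPrimitive_timeOrderedExp hK s)).sub h1
  simp only [ContinuousLinearMap.mul_apply', ← mul_assoc, timeOrderedExp_mul_swap hK, one_mul,
    ← hE] at h2
  have h3 := IsPrimitive.eq_zero_of_linear (isDysonSequence_dysonTerm hK s).intervalIntegrable
    (f := fun t => E t - timeOrderedExp K s t -
      timeOrderedExp K 0 t * ∫ u in s..t, timeOrderedExp K u 0 * P * E u) (by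
        convert! h2 using 2
        simp only [ContinuousLinearMap.mul_apply']
        noncomm_ring) (s := s)
    (by simp [hE, timeOrderedExp_self hK, timeOrderedExp_self hKP]) t
  rw [sub_sub, sub_eq_zero] at h3
  exact h3

/-- Uniformity in `P` provides the dominating constant in the limits below; the majorant of the
generator is `‖K‖ + 1`. -/
theorem exists_norm_timeOrderedExp_add_const_le (hK : ∀ a b, IntervalIntegrable K volume a b)
    (s t : ℝ) : ∃ C, 0 ≤ C ∧ ∀ P : H →L[ℂ] H, ‖P‖ ≤ 1 → ∀ u ∈ uIcc s t,
      ‖timeOrderedExp (fun u => K u + P) s u‖ ≤ C := by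
  have hκ : ∀ a b, IntervalIntegrable (fun u => ‖K u‖ + 1) volume a b := fun a b =>
    (hK a b).norm.add intervalIntegrable_const
  refine ⟨Real.exp |∫ v in s..t, (‖K v‖ + 1)|, (Real.exp_pos _).le, fun P hP u hu => ?_⟩
  refine (norm_timeOrderedExp_le (intervalIntegrable_add_const hK P) hκ (fun v => ?_) s u).trans ?_
  · exact (norm_add_le _ _).trans (by gcongr)
  · refine Real.exp_le_exp.2 (abs_integral_mono_interval
      (uIoc_subset_uIoc_of_uIcc_subset_uIcc (uIcc_subset_uIcc_left hu)) ?_ (hκ s t))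
    exact .of_forall fun v => by positivity

theorem tendsto_timeOrderedExp_add_const (hK : ∀ a b, IntervalIntegrable K volume a b) {ι : Type*}
    {l : Filter ι} {P : ι → H →L[ℂ] H} (hP : Tendsto P l (𝓝 0)) (s t : ℝ) :
    Tendsto (fun i => timeOrderedExp (fun u => K u + P i) s t) l (𝓝 (timeOrderedExp K s t)) := by
  obtain ⟨C, hC0, hC⟩ := exists_norm_timeOrderedExp_add_const_le hK s t
  obtain ⟨D, hD⟩ := (isCompact_uIcc (a := s) (b := t)).exists_bound_of_continuousOn
    (continuous_timeOrderedExp_left hK 0).continuousOn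
  have hD0 : 0 ≤ D := (norm_nonneg _).trans (hD s left_mem_uIcc)
  rw [tendsto_iff_norm_sub_tendsto_zero]
  have hlim : Tendsto (fun i => ‖timeOrderedExp K 0 t‖ * (D * ‖P i‖ * C * |t - s|)) l (𝓝 0) := by
    have := ((((tendsto_zero_iff_norm_tendsto_zero.1 hP).const_mul D).mul_const C).mul_const
      |t - s|).const_mul ‖timeOrderedExp K 0 t‖
    simpa using this
  refine squeeze_zero' (.of_forall fun _ => norm_nonneg _) ?_ hlim
  have hev : ∀ᶠ i in l, ‖P i‖ ≤ 1 := by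
    filter_upwards [(tendsto_zero_iff_norm_tendsto_zero.1 hP).eventually (gt_mem_nhds one_pos)]
      with i hi using hi.le
  filter_upwards [hev] with i hi
  rw [timeOrderedExp_add_const hK (P i), add_sub_cancel_left]
  refine (norm_mul_le _ _).trans ?_
  gcongr
  refine norm_integral_le_of_norm_le_const fun u hu => ?_
  have hu' := uIoc_subset_uIcc hu
  refine (norm_mul_le _ _).trans (mul_le_mul ((norm_mul_le _ _).trans ?_) (hC _ hi u hu')
    (norm_nonneg _) (by positivity))
  gcongr
  exact hD u hu'

/-- Variation of constants expresses the difference quotient exactly, with `τ⁻¹ P(τ)` in place of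
`P'`; dominated convergence finishes. Writing the propagator from `u` to `t` through time `0` keeps
`t` out of the integrand. -/
theorem hasDerivAt_timeOrderedExp_add_const (hK : ∀ a b, IntervalIntegrable K volume a b)
    {P : ℝ → H →L[ℂ] H} {P' : H →L[ℂ] H} (hP : HasDerivAt P P' 0) (hP0 : P 0 = 0) (s t : ℝ) :
    HasDerivAt (fun τ => timeOrderedExp (fun u => K u + P τ) s t)
      (timeOrderedExp K 0 t * ∫ u in s..t, timeOrderedExp K u 0 * P' * timeOrderedExp K s u) 0 := by
  obtain ⟨C, hC0, hC⟩ := exists_norm_timeOrderedExp_add_const_le hK s t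
  obtain ⟨D, hD⟩ := (isCompact_uIcc (a := s) (b := t)).exists_bound_of_continuousOn
    (continuous_timeOrderedExp_left hK 0).continuousOn
  have hD0 : 0 ≤ D := (norm_nonneg _).trans (hD s left_mem_uIcc)
  have hPt : Tendsto P (𝓝[≠] 0) (𝓝 0) := by
    have := hP.continuousAt.tendsto
    rw [hP0] at this
    exact this.mono_left nhdsWithin_le_nhds
  have hslope : Tendsto (fun τ : ℝ => τ⁻¹ • P τ) (𝓝[≠] 0) (𝓝 P') := by
    simpa [hP0] using hasDerivAt_iff_tendsto_slope_zero.1 hP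
  rw [hasDerivAt_iff_tendsto_slope_zero]
  have hint : Tendsto (fun τ : ℝ => ∫ u in s..t, timeOrderedExp K u 0 * (τ⁻¹ • P τ) *
      timeOrderedExp (fun u => K u + P τ) s u) (𝓝[≠] 0)
      (𝓝 (∫ u in s..t, timeOrderedExp K u 0 * P' * timeOrderedExp K s u)) := by
    refine tendsto_integral_filter_of_dominated_convergence (fun _ => D * (‖P'‖ + 1) * C)
      (.of_forall fun τ => ?_) ?_ intervalIntegrable_const (.of_forall fun u _ => ?_)
    · exact (((continuous_timeOrderedExp_left hK 0).mul continuous_const).mul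
        (continuous_timeOrderedExp (intervalIntegrable_add_const hK (P τ)) s)).aestronglyMeasurable
    · filter_upwards [(tendsto_zero_iff_norm_tendsto_zero.1 hPt).eventually (gt_mem_nhds one_pos),
        hslope.norm.eventually (gt_mem_nhds (lt_add_one ‖P'‖))] with τ h1 h2
      refine .of_forall fun u hu => ?_
      have hu' := uIoc_subset_uIcc hu
      refine (norm_mul_le _ _).trans (mul_le_mul ((norm_mul_le _ _).trans ?_) (hC _ h1.le u hu')
        (norm_nonneg _) (by positivity))
      gcongr
      exact hD u hu'
    · exact (hslope.const_mul _).mul (tendsto_timeOrderedExp_add_const hK hPt s u)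
  refine (hint.const_mul (timeOrderedExp K 0 t)).congr fun τ => ?_
  simp only [zero_add, hP0, add_zero]
  rw [timeOrderedExp_add_const hK (P τ), add_sub_cancel_left, ← mul_smul_comm,
    ← intervalIntegral.integral_smul]
  simp only [mul_smul_comm, smul_mul_assoc]

end TimeOrderedExp

/-! ### Records driven by time-dependent jumps -/

section Records

variable {E : Type*} [NormedAddCommGroup E] [InnerProductSpace ℂ E] [CompleteSpace E]
  {E' : Type*} [NormedAddCommGroup E'] [InnerProductSpace ℂ E'] [CompleteSpace E']
  {R : ℕ}

/-- The amplitudes obtained from `x` by applying `T_k(s)` at each emission in mode `k` at time `s`,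
with no evolution in between. -/
def jumpRecord (T : Fin R → ℝ → E →L[ℂ] E) (x : E) : Record R → E
  | [] => x
  | (s, k) :: r => T k s (jumpRecord T x r)

/-- The completely positive map `X ↦ ∑_k T_k(s)† X T_k(s)`. -/
noncomputable def jumpMap (T : Fin R → ℝ → E →L[ℂ] E) (s : ℝ) : (E →L[ℂ] E) →L[ℂ] (E →L[ℂ] E) :=
  ∑ k, ContinuousLinearMap.mulLeftRight ℂ (E →L[ℂ] E) (star (T k s)) (T k s)

/-- The functional `X ↦ ⟨χ, X χ⟩` of the `n`-quanta part of `χ = jumpRecord T x` up to time `t`. -/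
noncomputable def jumpMoment (T : Fin R → ℝ → E →L[ℂ] E) (x : E) : ℕ → ℝ → (E →L[ℂ] E) →L[ℂ] ℂ
  | 0, _ => (innerSL ℂ x).comp (ContinuousLinearMap.apply ℂ E x)
  | n + 1, t => ∫ s in (0 : ℝ)..t, (jumpMoment T x n s).comp (jumpMap T s)

/-- The functional `X ↦ ⟨χ, X χ⟩` of `χ = jumpRecord T x` up to time `t`. -/
noncomputable def jumpState (T : Fin R → ℝ → E →L[ℂ] E) (x : E) (t : ℝ) : (E →L[ℂ] E) →L[ℂ] ℂ :=
  ∑' n, jumpMoment T x n t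

theorem jumpMap_apply (T : Fin R → ℝ → E →L[ℂ] E) (s : ℝ) (X : E →L[ℂ] E) :
    jumpMap T s X = ∑ k, star (T k s) * X * T k s := by
  simp [jumpMap, sum_apply]

theorem jumpMap_nonneg (T : Fin R → ℝ → E →L[ℂ] E) (s : ℝ) {X : E →L[ℂ] E} (hX : 0 ≤ X) :
    0 ≤ jumpMap T s X := by
  rw [jumpMap_apply]
  exact Finset.sum_nonneg fun k _ => star_left_conjugate_nonneg hX _

theorem continuous_jumpMap {T : Fin R → ℝ → E →L[ℂ] E} (hT : ∀ k, Continuous (T k)) :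
    Continuous (jumpMap T) := by
  unfold jumpMap
  refine continuous_finsetSum _ fun k _ => ?_
  exact ((ContinuousLinearMap.mulLeftRight ℂ (E →L[ℂ] E)).continuous.comp
    (hT k).star).clm_apply (hT k)

/-- The quanta-number expansion is itself a Dyson series, on the dual of `B(E)`, with coefficient `φ
↦ φ ∘ jumpMap`. This gives convergence and the evolution equation of `jumpState` at once. -/
theorem isDysonSequence_jumpMoment {T : Fin R → ℝ → E →L[ℂ] E} (hT : ∀ k, Continuous (T k))
    (x : E) : IsDysonSequence
      (fun s => (ContinuousLinearMap.compL ℂ (E →L[ℂ] E) (E →L[ℂ] E) ℂ).flip (jumpMap T s))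
      0 ((innerSL ℂ x).comp (ContinuousLinearMap.apply ℂ E x)) (jumpMoment T x) where
  intervalIntegrable a b := Continuous.intervalIntegrable
    ((ContinuousLinearMap.compL ℂ (E →L[ℂ] E) (E →L[ℂ] E) ℂ).flip.continuous.comp
      (continuous_jumpMap hT)) a b
  zero _ := rfl
  succ _ _ := rfl

theorem recordInner_comp (P Q : E →L[ℂ] E') (n : ℕ) (t : ℝ) (f g : Record R → E) :
    recordInner n t (fun r => P (f r)) (fun r => Q (g r)) =
      recordInner n t f (fun r => (P.adjoint.comp Q) (g r)) := by
  induction n generalizing t f g with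
  | zero => simp [recordInner, ContinuousLinearMap.adjoint_inner_right]
  | succ n ih => simp only [recordInner, ih]

/-- Peeling off the latest emission conjugates the observable by `T_k(s)`, whence the induction over
all `X`. -/
theorem recordInner_jumpRecord {T : Fin R → ℝ → E →L[ℂ] E} (hT : ∀ k, Continuous (T k)) (x : E)
    (n : ℕ) (t : ℝ) (X : E →L[ℂ] E) :
    recordInner n t (jumpRecord T x) (fun r => X (jumpRecord T x r)) = jumpMoment T x n t X := by
  have h := isDysonSequence_jumpMoment hT x
  have hci : ∀ n (S : ℝ → (E →L[ℂ] E) →L[ℂ] (E →L[ℂ] E)), Continuous S →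
      Continuous fun s => (jumpMoment T x n s).comp (S s) := fun n S hS => (h.continuous n).clm_comp hS
  induction n generalizing t X with
  | zero => simp [recordInner, jumpMoment, jumpRecord]
  | succ n ih =>
    have key : ∀ k s, recordInner n s (fun r => jumpRecord T x ((s, k) :: r))
        (fun r => X (jumpRecord T x ((s, k) :: r))) =
          jumpMoment T x n s (star (T k s) * X * T k s) := by
      intro k s
      rw [← ih]
      exact recordInner_comp (T k s) (X.comp (T k s)) n s (jumpRecord T x) (jumpRecord T x)
    simp only [recordInner, key, jumpMoment]
    rw [ContinuousLinearMap.intervalIntegral_apply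
      ((hci n _ (continuous_jumpMap hT)).intervalIntegrable 0 t)]
    simp only [ContinuousLinearMap.comp_apply, jumpMap_apply, map_sum]
    refine (intervalIntegral.integral_finsetSum fun k _ => Continuous.intervalIntegrable ?_ _ _).symm
    exact (h.continuous n).clm_apply (((hT k).star.mul continuous_const).mul (hT k))

theorem hasSum_jumpMoment {T : Fin R → ℝ → E →L[ℂ] E} (hT : ∀ k, Continuous (T k)) (x : E)
    (t : ℝ) (X : E →L[ℂ] E) :
    HasSum (fun n => jumpMoment T x n t X) (jumpState T x t X) :=
  (ContinuousLinearMap.apply ℂ ℂ X).hasSum ((isDysonSequence_jumpMoment hT x).summable t).hasSum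

/-- Every Fock inner product of linear images of a record is a value of the single functional
`jumpState`. -/
theorem fockInner_jumpRecord {T : Fin R → ℝ → E →L[ℂ] E} (hT : ∀ k, Continuous (T k)) (x : E)
    (t : ℝ) (P Q : E →L[ℂ] E') :
    fockInner t (fun r => P (jumpRecord T x r)) (fun r => Q (jumpRecord T x r)) =
      jumpState T x t (P.adjoint.comp Q) := by
  simp only [fockInner, recordInner_comp, recordInner_jumpRecord hT]
  exact (hasSum_jumpMoment hT x t _).tsum_eq

theorem isPrimitive_jumpState {T : Fin R → ℝ → E →L[ℂ] E} (hT : ∀ k, Continuous (T k)) (x : E) :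
    IsPrimitive (jumpState T x) (fun s => (jumpState T x s).comp (jumpMap T s)) :=
  (isDysonSequence_jumpMoment hT x).isPrimitive_tsum

theorem jumpState_zero {T : Fin R → ℝ → E →L[ℂ] E} (hT : ∀ k, Continuous (T k)) (x : E)
    (X : E →L[ℂ] E) : jumpState T x 0 X = inner ℂ x (X x) := by
  rw [jumpState, (isDysonSequence_jumpMoment hT x).tsum_self]
  simp

/-- `jumpMap` preserves positivity, and integration over `[0, t]` keeps the sign when `t ≥ 0`. -/
theorem jumpMoment_re_nonneg {T : Fin R → ℝ → E →L[ℂ] E} (hT : ∀ k, Continuous (T k)) (x : E)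
    (n : ℕ) {t : ℝ} (ht : 0 ≤ t) {X : E →L[ℂ] E} (hX : 0 ≤ X) : 0 ≤ (jumpMoment T x n t X).re := by
  induction n generalizing t X with
  | zero =>
    exact ((ContinuousLinearMap.nonneg_iff_isPositive X).1 hX).re_inner_nonneg_right x
  | succ n ih =>
    have hc := ((isDysonSequence_jumpMoment hT x).continuous n).clm_comp (continuous_jumpMap hT)
    have hc' : Continuous fun s => jumpMoment T x n s (jumpMap T s X) :=
      hc.clm_apply continuous_const
    have e : (jumpMoment T x (n + 1) t X).re =
        ∫ s in (0 : ℝ)..t, (jumpMoment T x n s (jumpMap T s X)).re := by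
      rw [jumpMoment, ContinuousLinearMap.intervalIntegral_apply (hc.intervalIntegrable 0 t)]
      exact (Complex.reCLM.intervalIntegral_comp_comm (hc'.intervalIntegrable 0 t)).symm
    rw [e]
    exact integral_nonneg ht fun s hs => ih hs.1 (jumpMap_nonneg T s hX)

theorem jumpState_re_nonneg {T : Fin R → ℝ → E →L[ℂ] E} (hT : ∀ k, Continuous (T k)) (x : E)
    {t : ℝ} (ht : 0 ≤ t) {X : E →L[ℂ] E} (hX : 0 ≤ X) : 0 ≤ (jumpState T x t X).re :=
  (Complex.hasSum_re (hasSum_jumpMoment hT x t X)).nonneg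
    fun n => jumpMoment_re_nonneg hT x n ht hX

/-- The Heisenberg-picture generator `X ↦ K† X + X K + ∑_k C_k† X C_k`. -/
noncomputable def heisenbergGenerator (K : E →L[ℂ] E) (C : Fin R → E →L[ℂ] E) (X : E →L[ℂ] E) : E →L[ℂ] E :=
  star K * X + X * K + ∑ k, star (C k) * X * C k

/-- The evolution equation of the reduced state of a collisional purification. -/
theorem isPrimitive_jumpState_conj {K G Y : ℝ → E →L[ℂ] E} {C : Fin R → E →L[ℂ] E}
    (hG : IsPrimitive G fun u => K u * G u) (hY : Continuous Y) (hGY : ∀ t, G t * Y t = 1) (x : E)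
    (X : E →L[ℂ] E) :
    IsPrimitive (fun t => jumpState (fun k s => Y s * C k * G s) x t (star (G t) * X * G t))
      (fun t => jumpState (fun k s => Y s * C k * G s) x t
        (star (G t) * heisenbergGenerator (K t) C X * G t)) := by
  have hT : ∀ k, Continuous fun s => Y s * C k * G s := fun k =>
    (hY.mul continuous_const).mul hG.continuous
  have h1 : IsPrimitive (fun t => star (G t)) (fun t => star (K t * G t)) :=
    hG.clm ((starL' ℝ : (E →L[ℂ] E) ≃L[ℝ] (E →L[ℂ] E)) : (E →L[ℂ] E) →L[ℝ] (E →L[ℂ] E))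
  have h2 := (h1.clm ((ContinuousLinearMap.mul ℂ (E →L[ℂ] E)).flip X)).bilin
    (ContinuousLinearMap.mul ℂ (E →L[ℂ] E)) hG
  have h3 := (isPrimitive_jumpState hT x).bilin (ContinuousLinearMap.id ℂ ((E →L[ℂ] E) →L[ℂ] ℂ)) h2
  simp only [ContinuousLinearMap.flip_apply, ContinuousLinearMap.mul_apply',
    ContinuousLinearMap.id_apply, ContinuousLinearMap.comp_apply, ← map_add] at h3
  convert! h3 using 3 with t
  -- Since `G Y = 1`, conjugating by the interaction-picture jump `Y C_k G` turns `G† X G` into `G†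
  -- (C_k† X C_k) G`, which has the same outer factors as the terms from `G'`.
  have hk : ∀ k, star (Y t * C k * G t) * (star (G t) * X * G t) * (Y t * C k * G t) =
      star (G t) * (star (C k) * X * C k) * G t := by
    intro k
    calc _ = star (G t * Y t * C k * G t) * X * (G t * Y t * C k * G t) := by
          simp only [star_mul, mul_assoc]
      _ = _ := by simp only [hGY, one_mul, star_mul, mul_assoc]
  rw [jumpMap_apply, Finset.sum_congr rfl fun k _ => hk k]
  simp only [heisenbergGenerator, mul_add, add_mul, Finset.mul_sum,
    Finset.sum_mul, star_mul, mul_assoc]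
  abel

end Records

/-! ### First-order block operators

A family of vectors of `H` and its derivative are carried together by `H × H`, on which a family of
operators with value `a` and derivative `b` acts by the lower triangular block operator
`(x, y) ↦ (a x, b x + a y)`. -/

section LowerBlock

variable {H : Type*} [NormedAddCommGroup H] [InnerProductSpace ℂ H] {R : ℕ}

/-- The Hilbert space `H × H`. -/
def BlockSpace (H : Type*) : Type _ := WithLp 2 (H × H)

noncomputable instance : NormedAddCommGroup (BlockSpace H) :=
  inferInstanceAs (NormedAddCommGroup (WithLp 2 (H × H)))

noncomputable instance : InnerProductSpace ℂ (BlockSpace H) :=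
  inferInstanceAs (InnerProductSpace ℂ (WithLp 2 (H × H)))

instance [CompleteSpace H] : CompleteSpace (BlockSpace H) :=
  inferInstanceAs (CompleteSpace (WithLp 2 (H × H)))

/-- The map `a ↦ I a P`. -/
noncomputable def sandwich {E : Type*} [NormedAddCommGroup E] [NormedSpace ℂ E]
    (I : H →L[ℂ] E) (P : E →L[ℂ] H) : (H →L[ℂ] H) →L[ℂ] (E →L[ℂ] E) :=
  (ContinuousLinearMap.compL ℂ E H E I).comp ((ContinuousLinearMap.compL ℂ E H H).flip P)

/-- The projection onto the value component. -/
noncomputable def fstBlock : BlockSpace H →L[ℂ] H := WithLp.fstL 2 ℂ H H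

/-- The projection onto the derivative component. -/
noncomputable def sndBlock : BlockSpace H →L[ℂ] H := WithLp.sndL 2 ℂ H H

/-- The inclusion of the value component. -/
noncomputable def inlBlock : H →L[ℂ] BlockSpace H :=
  ((WithLp.prodContinuousLinearEquiv 2 ℂ H H).symm : H × H →L[ℂ] WithLp 2 (H × H)).comp
    (ContinuousLinearMap.inl ℂ H H)

/-- The inclusion of the derivative component. -/
noncomputable def inrBlock : H →L[ℂ] BlockSpace H :=
  ((WithLp.prodContinuousLinearEquiv 2 ℂ H H).symm : H × H →L[ℂ] WithLp 2 (H × H)).comp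
    (ContinuousLinearMap.inr ℂ H H)

/-- The operator `(x, y) ↦ (a x, b x + a y)`. -/
noncomputable def lowerBlock (a b : H →L[ℂ] H) : BlockSpace H →L[ℂ] BlockSpace H :=
  sandwich inlBlock fstBlock a + sandwich inrBlock fstBlock b + sandwich inrBlock sndBlock a

@[simp] theorem fstBlock_inlBlock (x : H) : fstBlock (inlBlock x) = x := rfl

@[simp] theorem sndBlock_inlBlock (x : H) : sndBlock (inlBlock x) = 0 := rfl

@[simp] theorem fstBlock_inrBlock (x : H) : fstBlock (inrBlock x) = 0 := rfl

@[simp] theorem sndBlock_inrBlock (x : H) : sndBlock (inrBlock x) = x := rfl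

theorem block_ext {x y : BlockSpace H} (h1 : fstBlock x = fstBlock y)
    (h2 : sndBlock x = sndBlock y) : x = y :=
  WithLp.ofLp_injective 2 (Prod.ext h1 h2)

@[simp] theorem fstBlock_lowerBlock (a b : H →L[ℂ] H) (x : BlockSpace H) :
    fstBlock (lowerBlock a b x) = a (fstBlock x) := by
  simp [lowerBlock, sandwich]

@[simp] theorem sndBlock_lowerBlock (a b : H →L[ℂ] H) (x : BlockSpace H) :
    sndBlock (lowerBlock a b x) = b (fstBlock x) + a (sndBlock x) := by
  simp [lowerBlock, sandwich]

/-- Block operators multiply like the dual numbers `a + ε b`: the lower entry is the Leibniz rule.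
-/
theorem lowerBlock_mul (a b c e : H →L[ℂ] H) :
    lowerBlock a b * lowerBlock c e = lowerBlock (a * c) (a * e + b * c) := by
  refine ContinuousLinearMap.ext fun x => block_ext ?_ ?_
  · simp
  · simp; abel

theorem lowerBlock_one_zero : lowerBlock (1 : H →L[ℂ] H) 0 = 1 := by
  refine ContinuousLinearMap.ext fun x => block_ext ?_ ?_ <;> simp

variable [CompleteSpace H]

theorem IsPrimitive.lowerBlock {a a' b b' : ℝ → H →L[ℂ] H} (ha : IsPrimitive a a')
    (hb : IsPrimitive b b') :
    IsPrimitive (fun t => lowerBlock (a t) (b t)) (fun t => lowerBlock (a' t) (b' t)) :=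
  ((ha.clm (sandwich inlBlock fstBlock)).add (hb.clm (sandwich inrBlock fstBlock))).add
    (ha.clm (sandwich inrBlock sndBlock))

theorem _root_.Continuous.lowerBlock {a b : ℝ → H →L[ℂ] H} (ha : Continuous a)
    (hb : Continuous b) : Continuous fun t => lowerBlock (a t) (b t) :=
  (((sandwich inlBlock fstBlock).continuous.comp ha).add
    ((sandwich inrBlock fstBlock).continuous.comp hb)).add
    ((sandwich inrBlock sndBlock).continuous.comp ha)

/-- The operator of the sesquilinear form `(x, y) ↦ ⟨P x, B (Q y)⟩`. -/
noncomputable def blockForm (P Q : BlockSpace H →L[ℂ] H) (B : H →L[ℂ] H) :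
    BlockSpace H →L[ℂ] BlockSpace H :=
  P.adjoint.comp (B.comp Q)

theorem inner_blockForm (P Q : BlockSpace H →L[ℂ] H) (B : H →L[ℂ] H)
    (x y : BlockSpace H) : inner ℂ x (blockForm P Q B y) = inner ℂ (P x) (B (Q y)) := by
  simp [blockForm, ContinuousLinearMap.adjoint_inner_right]

theorem blockForm_nonneg (P : BlockSpace H →L[ℂ] H) {B : H →L[ℂ] H} (hB : 0 ≤ B) :
    0 ≤ blockForm P P B := by
  rw [ContinuousLinearMap.nonneg_iff_isPositive] at hB ⊢
  exact hB.adjoint_conj P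

theorem inner_heisenbergGenerator {E : Type*} [NormedAddCommGroup E] [InnerProductSpace ℂ E]
    [CompleteSpace E] (K : E →L[ℂ] E) (C : Fin R → E →L[ℂ] E) (X : E →L[ℂ] E) (x y : E) :
    inner ℂ x (heisenbergGenerator K C X y) =
      inner ℂ (K x) (X y) + inner ℂ x (X (K y)) + ∑ k, inner ℂ (C k x) (X (C k y)) := by
  simp [heisenbergGenerator, sum_apply,
    ContinuousLinearMap.star_eq_adjoint, ContinuousLinearMap.adjoint_inner_right]

variable {K K' : H →L[ℂ] H} {C C' : Fin R → H →L[ℂ] H}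

/-- `hK` is the weak form of `K† + K + ∑ C_k† C_k = 0`; the conserved quantity is `⟨Ψ, Ψ⟩`. -/
theorem heisenbergGenerator_blockForm_fst_fst
    (hK : ∀ x y, inner ℂ (K x) y + inner ℂ x (K y) + ∑ k, inner ℂ (C k x) (C k y) = 0) :
    heisenbergGenerator (lowerBlock K K') (fun k => lowerBlock (C k) (C' k))
      (blockForm fstBlock fstBlock 1) = 0 := by
  refine ContinuousLinearMap.ext fun y => ext_inner_left ℂ fun x => ?_
  simp [inner_heisenbergGenerator, inner_blockForm, hK]

/-- `hK'` is the weak form of `K' + ∑ C_k† C'_k = 0`, half of the derivative of the normalization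
identity. It cancels the source terms in the evolution of `⟨Ψ, Ψ'⟩`. -/
theorem heisenbergGenerator_blockForm_fst_snd
    (hK : ∀ x y, inner ℂ (K x) y + inner ℂ x (K y) + ∑ k, inner ℂ (C k x) (C k y) = 0)
    (hK' : ∀ x y, inner ℂ x (K' y) + ∑ k, inner ℂ (C k x) (C' k y) = 0) :
    heisenbergGenerator (lowerBlock K K') (fun k => lowerBlock (C k) (C' k))
      (blockForm fstBlock sndBlock 1) = 0 := by
  refine ContinuousLinearMap.ext fun y => ext_inner_left ℂ fun x => ?_
  have h1 := hK (fstBlock x) (sndBlock y)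
  have h2 := hK' (fstBlock x) (fstBlock y)
  simp only [inner_heisenbergGenerator, inner_blockForm, fstBlock_lowerBlock, sndBlock_lowerBlock,
    inner_add_right, one_apply_eq_self, Finset.sum_add_distrib, zero_apply, inner_zero_right]
  linear_combination h1 + h2

/-- The cross terms of `⟨Ψ', Ψ'⟩` cancel by `hK'` and its conjugate; only the square of the emission
derivatives remains. -/
theorem heisenbergGenerator_blockForm_snd_snd
    (hK : ∀ x y, inner ℂ (K x) y + inner ℂ x (K y) + ∑ k, inner ℂ (C k x) (C k y) = 0)
    (hK' : ∀ x y, inner ℂ x (K' y) + ∑ k, inner ℂ (C k x) (C' k y) = 0) :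
    heisenbergGenerator (lowerBlock K K') (fun k => lowerBlock (C k) (C' k))
      (blockForm sndBlock sndBlock 1) =
        blockForm fstBlock fstBlock (∑ k, star (C' k) * C' k) := by
  refine ContinuousLinearMap.ext fun y => ext_inner_left ℂ fun x => ?_
  have h1 := hK (sndBlock x) (sndBlock y)
  have h2 := hK' (sndBlock x) (fstBlock y)
  have h3 := congrArg (starRingEnd ℂ) (hK' (sndBlock y) (fstBlock x))
  simp only [map_add, map_sum, inner_conj_symm, map_zero] at h3
  simp only [inner_heisenbergGenerator, inner_blockForm, sndBlock_lowerBlock,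
    inner_add_right, inner_add_left, one_apply_eq_self, Finset.sum_add_distrib, sum_apply, inner_sum,
    mul_apply_eq_comp, ContinuousLinearMap.star_eq_adjoint,
    ContinuousLinearMap.adjoint_inner_right]
  linear_combination h1 + h2 + h3

end LowerBlock

/-! ### The propagator together with its derivative along a constant perturbation -/

section Lifted

variable {H : Type*} [NormedAddCommGroup H] [InnerProductSpace ℂ H] [CompleteSpace H] {R : ℕ}
  {K : ℝ → H →L[ℂ] H} {K' : H →L[ℂ] H}

/-- The primitive of the perturbation `K'` in the interaction picture of `K`. -/
noncomputable def interactionIntegral (K : ℝ → H →L[ℂ] H) (K' : H →L[ℂ] H) (t : ℝ) : H →L[ℂ] H :=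
  ∫ u in (0 : ℝ)..t, timeOrderedExp K u 0 * K' * timeOrderedExp K 0 u

/-- The propagator from time `0` together with its derivative along `K'`. -/
noncomputable def liftedPropagator (K : ℝ → H →L[ℂ] H) (K' : H →L[ℂ] H) (t : ℝ) :
    BlockSpace H →L[ℂ] BlockSpace H :=
  lowerBlock (timeOrderedExp K 0 t) (timeOrderedExp K 0 t * interactionIntegral K K' t)

/-- The inverse of `liftedPropagator`. -/
noncomputable def liftedInverse (K : ℝ → H →L[ℂ] H) (K' : H →L[ℂ] H) (t : ℝ) :
    BlockSpace H →L[ℂ] BlockSpace H :=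
  lowerBlock (timeOrderedExp K t 0) (-(interactionIntegral K K' t * timeOrderedExp K t 0))

theorem continuous_interaction (hK : ∀ a b, IntervalIntegrable K volume a b) (K' : H →L[ℂ] H) :
    Continuous fun u => timeOrderedExp K u 0 * K' * timeOrderedExp K 0 u :=
  ((continuous_timeOrderedExp_left hK 0).mul continuous_const).mul (continuous_timeOrderedExp hK 0)

theorem isPrimitive_interactionIntegral (hK : ∀ a b, IntervalIntegrable K volume a b)
    (K' : H →L[ℂ] H) : IsPrimitive (interactionIntegral K K')
      (fun u => timeOrderedExp K u 0 * K' * timeOrderedExp K 0 u) :=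
  isPrimitive_integral (fun a b => (continuous_interaction hK K').intervalIntegrable a b) 0

theorem isPrimitive_liftedPropagator (hK : ∀ a b, IntervalIntegrable K volume a b)
    (K' : H →L[ℂ] H) : IsPrimitive (liftedPropagator K K')
      (fun u => lowerBlock (K u) K' * liftedPropagator K K' u) := by
  have h1 := isPrimitive_timeOrderedExp hK 0
  have h2 := h1.lowerBlock (h1.bilin (ContinuousLinearMap.mul ℂ (H →L[ℂ] H))
    (isPrimitive_interactionIntegral hK K'))
  simp only [ContinuousLinearMap.mul_apply', ← mul_assoc, timeOrderedExp_mul_swap hK, one_mul] at h2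
  convert! h2 using 2
  rw [liftedPropagator, lowerBlock_mul, mul_assoc]

theorem continuous_liftedInverse (hK : ∀ a b, IntervalIntegrable K volume a b)
    (K' : H →L[ℂ] H) : Continuous (liftedInverse K K') :=
  (continuous_timeOrderedExp_left hK 0).lowerBlock
    ((isPrimitive_interactionIntegral hK K').continuous.mul
      (continuous_timeOrderedExp_left hK 0)).neg

/-- The lower entry is exactly the derivative of the propagator from `s` to `t` computed in
`hasDerivAt_timeOrderedExp_add_const`; this ties the block calculus to actual derivatives. -/
theorem liftedPropagator_mul_liftedInverse (hK : ∀ a b, IntervalIntegrable K volume a b)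
    (K' : H →L[ℂ] H) (s t : ℝ) : liftedPropagator K K' t * liftedInverse K K' s =
      lowerBlock (timeOrderedExp K s t) (timeOrderedExp K 0 t *
        ∫ u in s..t, timeOrderedExp K u 0 * K' * timeOrderedExp K s u) := by
  have e : ∫ u in s..t, timeOrderedExp K u 0 * K' * timeOrderedExp K s u =
      (interactionIntegral K K' t - interactionIntegral K K' s) * timeOrderedExp K s 0 := by
    rw [(isPrimitive_interactionIntegral hK K').sub_eq s t]
    have := ((ContinuousLinearMap.mul ℂ (H →L[ℂ] H)).flip
      (timeOrderedExp K s 0)).intervalIntegral_comp_comm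
      ((continuous_interaction hK K').intervalIntegrable (μ := volume) s t)
    simp only [ContinuousLinearMap.flip_apply, ContinuousLinearMap.mul_apply', mul_assoc,
      timeOrderedExp_mul hK] at this
    simp only [mul_assoc, this]
  rw [liftedPropagator, liftedInverse, lowerBlock_mul, timeOrderedExp_mul hK, e]
  congr 1
  noncomm_ring

theorem liftedPropagator_mul_liftedInverse_self (hK : ∀ a b, IntervalIntegrable K volume a b)
    (K' : H →L[ℂ] H) (t : ℝ) : liftedPropagator K K' t * liftedInverse K K' t = 1 := by
  rw [liftedPropagator_mul_liftedInverse hK, integral_same, mul_zero, timeOrderedExp_self hK,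
    lowerBlock_one_zero]

theorem liftedPropagator_zero (hK : ∀ a b, IntervalIntegrable K volume a b)
    (K' : H →L[ℂ] H) : liftedPropagator K K' 0 = 1 := by
  rw [liftedPropagator, interactionIntegral, integral_same, mul_zero, timeOrderedExp_self hK,
    lowerBlock_one_zero]

/-- The jumps in the interaction picture of `liftedPropagator`. -/
noncomputable def liftedJump (K : ℝ → H →L[ℂ] H) (K' : H →L[ℂ] H) (C C' : Fin R → H →L[ℂ] H)
    (k : Fin R) (s : ℝ) : BlockSpace H →L[ℂ] BlockSpace H :=
  liftedInverse K K' s * lowerBlock (C k) (C' k) * liftedPropagator K K' s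

theorem continuous_liftedJump (hK : ∀ a b, IntervalIntegrable K volume a b)
    (K' : H →L[ℂ] H) (C C' : Fin R → H →L[ℂ] H) (k : Fin R) :
    Continuous (liftedJump K K' C C' k) :=
  ((continuous_liftedInverse hK K').mul continuous_const).mul
    (isPrimitive_liftedPropagator hK K').continuous

/-- The amplitudes of a purification together with their derivatives. -/
noncomputable def liftedRecord (K : ℝ → H →L[ℂ] H) (K' : H →L[ℂ] H) (C C' : Fin R → H →L[ℂ] H)
    (ψ : H) (t : ℝ) (r : Record R) : BlockSpace H :=
  liftedPropagator K K' t (jumpRecord (liftedJump K K' C C') (inlBlock ψ) r)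

/-- The functional `B ↦ ⟨P Ψ, B (Q Ψ)⟩` of `Ψ = liftedRecord K K' C C' ψ t`. -/
noncomputable def liftedForm (K : ℝ → H →L[ℂ] H) (K' : H →L[ℂ] H) (C C' : Fin R → H →L[ℂ] H)
    (ψ : H) (t : ℝ) (X : BlockSpace H →L[ℂ] BlockSpace H) : ℂ :=
  jumpState (liftedJump K K' C C') (inlBlock ψ) t
    (star (liftedPropagator K K' t) * X * liftedPropagator K K' t)

variable {C C' : Fin R → H →L[ℂ] H}

theorem fockInner_liftedRecord (hK : ∀ a b, IntervalIntegrable K volume a b) (ψ : H) (t : ℝ)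
    (P Q : BlockSpace H →L[ℂ] H) (B : H →L[ℂ] H) :
    fockInner t (fun r => P (liftedRecord K K' C C' ψ t r))
      (fun r => B (Q (liftedRecord K K' C C' ψ t r))) =
      liftedForm K K' C C' ψ t (blockForm P Q B) := by
  have := fockInner_jumpRecord (continuous_liftedJump hK K' C C') (inlBlock ψ) t
    (P.comp (liftedPropagator K K' t)) ((B.comp Q).comp (liftedPropagator K K' t))
  rw [ContinuousLinearMap.adjoint_comp] at this
  exact this

theorem isPrimitive_liftedForm (hK : ∀ a b, IntervalIntegrable K volume a b) (ψ : H)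
    (X : BlockSpace H →L[ℂ] BlockSpace H) :
    IsPrimitive (fun t => liftedForm K K' C C' ψ t X) (fun t => liftedForm K K' C C' ψ t
      (heisenbergGenerator (lowerBlock (K t) K') (fun k => lowerBlock (C k) (C' k)) X)) :=
  isPrimitive_jumpState_conj (isPrimitive_liftedPropagator hK K') (continuous_liftedInverse hK K')
    (liftedPropagator_mul_liftedInverse_self hK K') _ X

theorem liftedForm_zero_time (hK : ∀ a b, IntervalIntegrable K volume a b) (ψ : H)
    (P Q : BlockSpace H →L[ℂ] H) (B : H →L[ℂ] H) :
    liftedForm K K' C C' ψ 0 (blockForm P Q B) =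
      inner ℂ (P (inlBlock ψ)) (B (Q (inlBlock ψ))) := by
  rw [liftedForm, liftedPropagator_zero hK, star_one, one_mul, mul_one,
    jumpState_zero (continuous_liftedJump hK K' C C'), inner_blockForm]

theorem liftedForm_re_nonneg (hK : ∀ a b, IntervalIntegrable K volume a b) (ψ : H) {t : ℝ}
    (ht : 0 ≤ t) {X : BlockSpace H →L[ℂ] BlockSpace H} (hX : 0 ≤ X) :
    0 ≤ (liftedForm K K' C C' ψ t X).re :=
  jumpState_re_nonneg (continuous_liftedJump hK K' C C') _ ht (star_left_conjugate_nonneg hX _)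

theorem liftedForm_eq_of_heisenbergGenerator_eq_zero
    (hK : ∀ a b, IntervalIntegrable K volume a b) (ψ : H)
    {X : BlockSpace H →L[ℂ] BlockSpace H} (hX : ∀ t, heisenbergGenerator
      (lowerBlock (K t) K') (fun k => lowerBlock (C k) (C' k)) X = 0) (t : ℝ) :
    liftedForm K K' C C' ψ t X = liftedForm K K' C C' ψ 0 X := by
  rw [(isPrimitive_liftedForm hK ψ X).eq_add 0 t]
  simp [hX, liftedForm]

end Lifted

/-! ### The collisional purification and its derivative -/

section Collisional

variable {H : Type*} [NormedAddCommGroup H] [InnerProductSpace ℂ H] [CompleteSpace H] {R : ℕ}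
  {Hc : ℝ → H →L[ℂ] H} {J : Fin R → H →L[ℂ] H}

/-- The emission amplitudes `-i c_k J_k`. -/
noncomputable def emission (J : Fin R → H →L[ℂ] H) (c : Fin R → ℝ) (k : Fin R) : H →L[ℂ] H :=
  (-Complex.I * (c k : ℂ)) • J k

/-- The derivative `-∑_k √γ_k g_k J_k† J_k` of the no-jump generator when `√γ_k` has
derivative `g_k`. -/
noncomputable def noJumpDeriv (J : Fin R → H →L[ℂ] H) (γ g : Fin R → ℝ) : H →L[ℂ] H :=
  -∑ k, ((Real.sqrt (γ k) * g k : ℝ) : ℂ) • (star (J k) * J k)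

theorem intervalIntegrable_noJumpGenerator (hHc : LocallyIntegrable Hc volume)
    (J : Fin R → H →L[ℂ] H) (γ : Fin R → ℝ) (a b : ℝ) :
    IntervalIntegrable (noJumpGenerator Hc J γ) volume a b := by
  have h : IntervalIntegrable Hc volume a b :=
    (hHc.integrableOn_isCompact isCompact_uIcc).intervalIntegrable
  exact (h.smul Complex.I).neg.sub intervalIntegrable_const

omit [CompleteSpace H] in
theorem inner_emission (c c' : Fin R → ℝ) (k : Fin R) (x y : H) :
    inner ℂ (emission J c k x) (emission J c' k y) =
      ((c k * c' k : ℝ) : ℂ) * inner ℂ (J k x) (J k y) := by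
  simp only [emission, smul_apply, inner_smul_left, inner_smul_right, map_mul, map_neg,
    Complex.conj_I, Complex.conj_ofReal, neg_neg]
  push_cast
  linear_combination (-(c k * c' k * inner ℂ (J k x) (J k y)) : ℂ) * Complex.I_mul_I

theorem star_emission_mul_emission (c : Fin R → ℝ) (k : Fin R) :
    star (emission J c k) * emission J c k = ((c k ^ 2 : ℝ) : ℂ) • (star (J k) * J k) := by
  refine ContinuousLinearMap.ext fun y => ext_inner_left ℂ fun x => ?_
  simp only [mul_apply_eq_comp, smul_apply, ContinuousLinearMap.star_eq_adjoint,
    ContinuousLinearMap.adjoint_inner_right, inner_smul_right, inner_emission, sq]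

/-- The Hamiltonian part is anti-Hermitian and cancels; twice the damping `-½ ∑ γ_k J_k† J_k`
balances the emissions. -/
theorem inner_noJumpGenerator_add (hHc' : ∀ t, IsSelfAdjoint (Hc t)) {γ : Fin R → ℝ}
    (hγ : ∀ k, 0 ≤ γ k) (t : ℝ) (x y : H) :
    inner ℂ (noJumpGenerator Hc J γ t x) y + inner ℂ x (noJumpGenerator Hc J γ t y) +
      ∑ k, inner ℂ (emission J (fun k => Real.sqrt (γ k)) k x)
        (emission J (fun k => Real.sqrt (γ k)) k y) = 0 := by
  have hs : inner ℂ (Hc t x) y = inner ℂ x (Hc t y) := by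
    rw [← ContinuousLinearMap.adjoint_inner_right, ← ContinuousLinearMap.star_eq_adjoint,
      (hHc' t).star_eq]
  simp only [noJumpGenerator, sub_apply, neg_apply, smul_apply, sum_apply, inner_sub_left,
    inner_sub_right, inner_neg_left, inner_neg_right, inner_smul_left, inner_smul_right, sum_inner,
    inner_sum, mul_apply_eq_comp, ContinuousLinearMap.star_eq_adjoint,
    ContinuousLinearMap.adjoint_inner_right, ContinuousLinearMap.adjoint_inner_left,
    inner_emission, Complex.conj_I, Complex.conj_ofReal, Real.mul_self_sqrt (hγ _), hs, map_div₀,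
    map_one, map_ofNat]
  ring

/-- The factors `√γ_k` and `g_k` are real, so the phases `±i` of the emissions cancel and no
imaginary part is left over. -/
theorem inner_noJumpDeriv_add (γ g : Fin R → ℝ) (x y : H) :
    inner ℂ x (noJumpDeriv J γ g y) +
      ∑ k, inner ℂ (emission J (fun k => Real.sqrt (γ k)) k x) (emission J g k y) = 0 := by
  simp only [noJumpDeriv, neg_apply, smul_apply, sum_apply, inner_neg_right, inner_smul_right,
    inner_sum, mul_apply_eq_comp, ContinuousLinearMap.star_eq_adjoint,
    ContinuousLinearMap.adjoint_inner_right, inner_emission]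
  ring

/-- The purification and its derivative when `√γ_k` has derivative `g_k`. -/
noncomputable def liftedState (Hc : ℝ → H →L[ℂ] H) (J : Fin R → H →L[ℂ] H) (γ g : Fin R → ℝ)
    (ψ : H) (t : ℝ) (r : Record R) : BlockSpace H :=
  liftedRecord (noJumpGenerator Hc J γ) (noJumpDeriv J γ g)
    (emission J fun k => Real.sqrt (γ k)) (emission J g) ψ t r

theorem liftedRecord_cons {K : ℝ → H →L[ℂ] H} (hK : ∀ a b, IntervalIntegrable K volume a b)
    (K' : H →L[ℂ] H) (C C' : Fin R → H →L[ℂ] H) (ψ : H) (s t : ℝ) (k : Fin R) (r : Record R) :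
    liftedRecord K K' C C' ψ t ((s, k) :: r) =
      lowerBlock (timeOrderedExp K s t) (timeOrderedExp K 0 t *
        ∫ u in s..t, timeOrderedExp K u 0 * K' * timeOrderedExp K s u)
        (lowerBlock (C k) (C' k) (liftedRecord K K' C C' ψ s r)) := by
  rw [← liftedPropagator_mul_liftedInverse hK]
  rfl

/-- The blocks are lower triangular, so the value component never sees `g`. -/
theorem fstBlock_liftedState (hHc : LocallyIntegrable Hc volume) (J : Fin R → H →L[ℂ] H)
    (γ g : Fin R → ℝ) (ψ : H) (t : ℝ) (r : Record R) :
    fstBlock (liftedState Hc J γ g ψ t r) = collisionalState Hc J γ ψ t r := by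
  induction r generalizing t with
  | nil => simp [liftedState, liftedRecord, jumpRecord, liftedPropagator, collisionalState]
  | cons a r ih =>
    obtain ⟨s, k⟩ := a
    rw [liftedState, liftedRecord_cons (intervalIntegrable_noJumpGenerator hHc J γ),
      fstBlock_lowerBlock, fstBlock_lowerBlock, collisionalState, ← ih]
    rfl

theorem collisionalState_eq_fstBlock (hHc : LocallyIntegrable Hc volume) (J : Fin R → H →L[ℂ] H)
    (γ g : Fin R → ℝ) (ψ : H) (t : ℝ) : collisionalState Hc J γ ψ t =
      fun r => fstBlock (liftedState Hc J γ g ψ t r) :=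
  funext fun r => (fstBlock_liftedState hHc J γ g ψ t r).symm

/-- `γ = (√γ)²` holds only where `γ ≥ 0`, hence the hypothesis on a neighbourhood. -/
theorem hasDerivAt_of_sqrt {γ : ℝ → ℝ} {g : ℝ} (hγ : ∀ᶠ τ in 𝓝 0, 0 ≤ γ τ)
    (hg : HasDerivAt (fun τ => Real.sqrt (γ τ)) g 0) :
    HasDerivAt γ (2 * (Real.sqrt (γ 0) * g)) 0 := by
  have h := hg.pow 2
  have e : γ =ᶠ[𝓝 0] (fun τ => Real.sqrt (γ τ)) ^ 2 := by
    filter_upwards [hγ] with τ hτ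
    simp [Real.sq_sqrt hτ]
  convert! h.congr_of_eventuallyEq e using 1
  push_cast; ring

omit [CompleteSpace H] in
theorem _root_.HasDerivAt.clm_apply_complex {G : ℝ → H →L[ℂ] H} {G' : H →L[ℂ] H} {x : ℝ → H}
    {x' : H} {τ : ℝ} (hG : HasDerivAt G G' τ) (hx : HasDerivAt x x' τ) :
    HasDerivAt (fun τ => G τ (x τ)) (G' (x τ) + G τ x') τ :=
  ((ContinuousLinearMap.restrictScalarsL ℂ H H ℝ ℝ).hasFDerivAt.comp_hasDerivAt τ hG).clm_apply hx

/-- Induction on the record: each emission applies one jump and one propagator, and each of the two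
products is differentiated by the Leibniz rule built into the blocks. -/
theorem hasDerivAt_collisionalState (hHc : LocallyIntegrable Hc volume) (J : Fin R → H →L[ℂ] H)
    {γ : ℝ → Fin R → ℝ} {γ₀ g : Fin R → ℝ} (h0 : γ 0 = γ₀) (hγ : ∀ᶠ τ in 𝓝 0, ∀ k, 0 ≤ γ τ k)
    (hg : ∀ k, HasDerivAt (fun τ => Real.sqrt (γ τ k)) (g k) 0) (ψ : H) (t : ℝ) (r : Record R) :
    HasDerivAt (fun τ => collisionalState Hc J (γ τ) ψ t r)
      (sndBlock (liftedState Hc J γ₀ g ψ t r)) 0 := by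
  subst h0
  have hK := intervalIntegrable_noJumpGenerator hHc J (γ 0)
  have hG : ∀ s t, HasDerivAt (fun τ => timeOrderedExp (noJumpGenerator Hc J (γ τ)) s t)
      (timeOrderedExp (noJumpGenerator Hc J (γ 0)) 0 t *
        ∫ u in s..t, timeOrderedExp (noJumpGenerator Hc J (γ 0)) u 0 * noJumpDeriv J (γ 0) g *
          timeOrderedExp (noJumpGenerator Hc J (γ 0)) s u) 0 := by
    intro s t
    -- Varying the rates changes the no-jump generator by an operator independent of time, so the
    -- constant-perturbation results apply.
    have hP : HasDerivAt (fun τ => -((1 / 2 : ℂ) • ∑ k, ((γ τ k - γ 0 k : ℝ) : ℂ) •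
        (star (J k) * J k))) (noJumpDeriv J (γ 0) g) 0 := by
      have : HasDerivAt (fun τ => -((1 / 2 : ℂ) • ∑ k, ((γ τ k - γ 0 k : ℝ) : ℂ) •
          (star (J k) * J k))) (-((1 / 2 : ℂ) • ∑ k, ((2 * (Real.sqrt (γ 0 k) * g k) : ℝ) : ℂ) •
          (star (J k) * J k))) 0 := by
        have hs : HasDerivAt (fun τ => ∑ k, ((γ τ k - γ 0 k : ℝ) : ℂ) • (star (J k) * J k))
            (∑ k, ((2 * (Real.sqrt (γ 0 k) * g k) : ℝ) : ℂ) • (star (J k) * J k)) 0 := by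
          refine HasDerivAt.fun_sum fun k _ => ?_
          have := hasDerivAt_of_sqrt (hγ.mono fun τ hτ => hτ k) (hg k)
          exact (this.sub_const (γ 0 k)).ofReal_comp.smul_const _
        exact (hs.const_smul (1 / 2 : ℂ)).neg
      convert! this using 1
      rw [noJumpDeriv, Finset.smul_sum]
      congr 1
      refine Finset.sum_congr rfl fun k _ => ?_
      rw [smul_smul]
      congr 1
      push_cast; ring
    have h := hasDerivAt_timeOrderedExp_add_const hK hP (by simp) s t
    convert! h using 4 with τ u
    simp only [noJumpGenerator, Complex.ofReal_sub, sub_smul, Finset.sum_sub_distrib, smul_sub]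
    abel
  induction r generalizing t with
  | nil =>
    have h := (hG 0 t).clm_apply_complex (hasDerivAt_const 0 ψ)
    simpa [collisionalState, liftedState, liftedRecord, jumpRecord, liftedPropagator,
      interactionIntegral] using h
  | cons a r ih =>
    obtain ⟨s, k⟩ := a
    have h1 : HasDerivAt (fun τ => (-Complex.I * (Real.sqrt (γ τ k) : ℂ)) •
        J k (collisionalState Hc J (γ τ) ψ s r))
        (sndBlock (lowerBlock (emission J (fun k => Real.sqrt (γ 0 k)) k) (emission J g k)
          (liftedState Hc J (γ 0) g ψ s r))) 0 := by
      have h2 := ((hg k).ofReal_comp.const_mul (-Complex.I)).smul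
        (((J k).restrictScalars ℝ).hasFDerivAt.comp_hasDerivAt 0 (ih s))
      convert! h2 using 1
      rw [sndBlock_lowerBlock, fstBlock_liftedState hHc]
      simp only [emission, smul_apply, Function.comp_apply, ContinuousLinearMap.coe_restrictScalars']
      abel
    have h3 := (hG s t).clm_apply_complex h1
    simp only [collisionalState]
    convert! h3 using 1
    rw [liftedState, liftedRecord_cons hK, sndBlock_lowerBlock, fstBlock_lowerBlock,
      ← fstBlock_liftedState hHc J (γ 0) g ψ s r]
    rfl

/-! ### Expectation values in the reduced state -/

/-- The expectation value `⟨Ψ(t), B Ψ(t)⟩` of an observable of the probe. -/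
noncomputable def probeExpectation (Hc : ℝ → H →L[ℂ] H) (J : Fin R → H →L[ℂ] H) (γ : Fin R → ℝ)
    (ψ : H) (t : ℝ) (B : H →L[ℂ] H) : ℂ :=
  fockInner t (collisionalState Hc J γ ψ t) (fun r => B (collisionalState Hc J γ ψ t r))

/-- The right side does not depend on `g`; the choice `g = 0` transfers properties of `liftedForm`
to the probe. -/
theorem probeExpectation_eq_liftedForm (hHc : LocallyIntegrable Hc volume)
    (J : Fin R → H →L[ℂ] H) (γ g : Fin R → ℝ) (ψ : H) (t : ℝ) (B : H →L[ℂ] H) :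
    probeExpectation Hc J γ ψ t B = liftedForm (noJumpGenerator Hc J γ) (noJumpDeriv J γ g)
      (emission J fun k => Real.sqrt (γ k)) (emission J g) ψ t (blockForm fstBlock fstBlock B) := by
  rw [← fockInner_liftedRecord (intervalIntegrable_noJumpGenerator hHc J γ), probeExpectation,
    collisionalState_eq_fstBlock hHc J γ g ψ t]
  rfl

theorem continuous_probeExpectation (hHc : LocallyIntegrable Hc volume)
    (J : Fin R → H →L[ℂ] H) (γ : Fin R → ℝ) (ψ : H) (B : H →L[ℂ] H) :
    Continuous fun t => probeExpectation Hc J γ ψ t B := by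
  simp only [probeExpectation_eq_liftedForm hHc J γ 0 ψ]
  exact (isPrimitive_liftedForm (intervalIntegrable_noJumpGenerator hHc J γ) ψ _).continuous

theorem probeExpectation_zero_time (hHc : LocallyIntegrable Hc volume)
    (J : Fin R → H →L[ℂ] H) (γ : Fin R → ℝ) (ψ : H) (B : H →L[ℂ] H) :
    probeExpectation Hc J γ ψ 0 B = inner ℂ ψ (B ψ) := by
  rw [probeExpectation_eq_liftedForm hHc J γ 0 ψ,
    liftedForm_zero_time (intervalIntegrable_noJumpGenerator hHc J γ)]
  rfl

theorem probeExpectation_re_nonneg (hHc : LocallyIntegrable Hc volume)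
    (J : Fin R → H →L[ℂ] H) (γ : Fin R → ℝ) (ψ : H) {t : ℝ} (ht : 0 ≤ t) {B : H →L[ℂ] H}
    (hB : 0 ≤ B) : 0 ≤ (probeExpectation Hc J γ ψ t B).re := by
  rw [probeExpectation_eq_liftedForm hHc J γ 0 ψ]
  exact liftedForm_re_nonneg (intervalIntegrable_noJumpGenerator hHc J γ) ψ ht
    (blockForm_nonneg _ hB)

theorem probeExpectation_one (hHc : LocallyIntegrable Hc volume)
    (hHc' : ∀ t, IsSelfAdjoint (Hc t)) (J : Fin R → H →L[ℂ] H) {γ : Fin R → ℝ}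
    (hγ : ∀ k, 0 ≤ γ k) (ψ : H) (t : ℝ) :
    probeExpectation Hc J γ ψ t 1 = (‖ψ‖ : ℂ) ^ 2 := by
  rw [probeExpectation_eq_liftedForm hHc J γ 0 ψ, liftedForm_eq_of_heisenbergGenerator_eq_zero
    (intervalIntegrable_noJumpGenerator hHc J γ) ψ
    (fun t => heisenbergGenerator_blockForm_fst_fst (inner_noJumpGenerator_add hHc' hγ t)) t,
    liftedForm_zero_time (intervalIntegrable_noJumpGenerator hHc J γ)]
  exact inner_self_eq_norm_sq_to_K ψ

/-- `probeExpectation` as a linear functional. -/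
theorem exists_linearMap_probeExpectation (hHc : LocallyIntegrable Hc volume)
    (J : Fin R → H →L[ℂ] H) (γ : Fin R → ℝ) (ψ : H) (t : ℝ) :
    ∃ ω : (H →L[ℂ] H) →ₗ[ℂ] ℂ, ∀ B, probeExpectation Hc J γ ψ t B = ω B := by
  refine ⟨⟨⟨fun B => probeExpectation Hc J γ ψ t B, fun B B' => ?_⟩, fun c B => ?_⟩, fun B => rfl⟩
  · have : blockForm (H := H) fstBlock fstBlock (B + B') =
        blockForm fstBlock fstBlock B + blockForm fstBlock fstBlock B' := by
      simp [blockForm, ContinuousLinearMap.add_comp]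
    simp only [probeExpectation_eq_liftedForm hHc J γ 0 ψ, this, liftedForm, mul_add, add_mul,
      map_add]
  · have : blockForm (H := H) fstBlock fstBlock (c • B) =
        c • blockForm fstBlock fstBlock B := by
      simp [blockForm]
    simp only [probeExpectation_eq_liftedForm hHc J γ 0 ψ, this, liftedForm, mul_smul_comm,
      smul_mul_assoc, map_smul, RingHom.id_apply]

/-- The rate of change of `⟨Ψ, Ψ'⟩` vanishes. -/
theorem fockInner_collisionalState_sndBlock (hHc : LocallyIntegrable Hc volume)
    (hHc' : ∀ t, IsSelfAdjoint (Hc t)) (J : Fin R → H →L[ℂ] H) {γ : Fin R → ℝ}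
    (hγ : ∀ k, 0 ≤ γ k) (g : Fin R → ℝ) (ψ : H) (t : ℝ) :
    fockInner t (collisionalState Hc J γ ψ t) (fun r => sndBlock (liftedState Hc J γ g ψ t r)) =
      0 := by
  have hK := intervalIntegrable_noJumpGenerator hHc J γ
  have h := fockInner_liftedRecord (K' := noJumpDeriv J γ g) (C' := emission J g)
    (C := emission J fun k => Real.sqrt (γ k)) hK ψ t fstBlock sndBlock 1
  rw [liftedForm_eq_of_heisenbergGenerator_eq_zero hK ψ
    (fun t => heisenbergGenerator_blockForm_fst_snd (inner_noJumpGenerator_add hHc' hγ t)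
      (inner_noJumpDeriv_add γ g)) t,
    liftedForm_zero_time hK] at h
  simp only [one_apply_eq_self, sndBlock_inlBlock, inner_zero_right] at h
  rw [← h, collisionalState_eq_fstBlock hHc J γ g ψ t]
  rfl

/-- `Ψ'` starts at zero, since the initial state does not depend on the parameters, and its squared
norm accumulates at the rate found above. -/
theorem fockInner_sndBlock_sndBlock (hHc : LocallyIntegrable Hc volume)
    (hHc' : ∀ t, IsSelfAdjoint (Hc t)) (J : Fin R → H →L[ℂ] H) {γ : Fin R → ℝ}
    (hγ : ∀ k, 0 ≤ γ k) (g : Fin R → ℝ) (ψ : H) (t : ℝ) :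
    fockInner t (fun r => sndBlock (liftedState Hc J γ g ψ t r))
      (fun r => sndBlock (liftedState Hc J γ g ψ t r)) =
      ∫ s in (0 : ℝ)..t, probeExpectation Hc J γ ψ s
        (∑ k, ((g k ^ 2 : ℝ) : ℂ) • (star (J k) * J k)) := by
  have hK := intervalIntegrable_noJumpGenerator hHc J γ
  have h := fockInner_liftedRecord (K' := noJumpDeriv J γ g) (C' := emission J g)
    (C := emission J fun k => Real.sqrt (γ k)) hK ψ t sndBlock sndBlock 1
  rw [(isPrimitive_liftedForm hK ψ _).eq_add 0 t, liftedForm_zero_time hK] at h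
  simp only [one_apply_eq_self, sndBlock_inlBlock, inner_zero_right, zero_add,
    heisenbergGenerator_blockForm_snd_snd (inner_noJumpGenerator_add hHc' hγ _)
      (inner_noJumpDeriv_add γ g), star_emission_mul_emission] at h
  simp only [probeExpectation_eq_liftedForm hHc J γ g ψ]
  exact h

end Collisional

/-! ### The collisional quantum Fisher information -/

section QFI

variable {H : Type*} [NormedAddCommGroup H] [InnerProductSpace ℂ H] [CompleteSpace H] {R d : ℕ}
  {Hc : ℝ → H →L[ℂ] H} {γ : (Fin d → ℝ) → Fin R → ℝ} {θ : Fin d → ℝ}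

/-- The restriction of a differentiable function to a coordinate line has derivative
`partialDeriv`. -/
theorem hasDerivAt_partialDeriv {E : Type*} [NormedAddCommGroup E] [NormedSpace ℝ E]
    {f : (Fin d → ℝ) → E} (hf : DifferentiableAt ℝ f θ) (α : Fin d) :
    HasDerivAt (fun τ : ℝ => f (θ + τ • Pi.single α 1)) (partialDeriv f θ α) 0 :=
  hf.lineDifferentiableAt.hasLineDerivAt

theorem eventually_line {p : (Fin d → ℝ) → Prop} (hp : ∀ᶠ θ' in 𝓝 θ, p θ') (v : Fin d → ℝ) :
    ∀ᶠ τ : ℝ in 𝓝 0, p (θ + τ • v) := by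
  have : Tendsto (fun τ : ℝ => θ + τ • v) (𝓝 0) (𝓝 θ) := by
    have h : Continuous fun τ : ℝ => θ + τ • v := by fun_prop
    simpa using h.tendsto 0
  exact this.eventually hp

/-- As `⟨Ψ, Ψ'⟩ = 0`, the projection term drops and the diagonal entry is `4 ‖Ψ'‖²`. -/
theorem collisionalQFI_diag (hγ : ∀ᶠ θ' in 𝓝 θ, ∀ k, 0 ≤ γ θ' k)
    (hγd : ∀ k, DifferentiableAt ℝ (fun θ' => Real.sqrt (γ θ' k)) θ)
    (hHc : LocallyIntegrable Hc volume) (hHc' : ∀ t, IsSelfAdjoint (Hc t))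
    (J : Fin R → H →L[ℂ] H) (ψ : H) (t : ℝ) (α : Fin d) :
    collisionalQFI Hc J γ θ ψ t α α = ∑ k,
      4 * partialDeriv (fun θ' => Real.sqrt (γ θ' k)) θ α ^ 2 *
        ∫ s in (0 : ℝ)..t, (probeExpectation Hc J (γ θ) ψ s (star (J k) * J k)).re := by
  set g : Fin R → ℝ := fun k => partialDeriv (fun θ' => Real.sqrt (γ θ' k)) θ α with hg
  have hγ0 : ∀ k, 0 ≤ γ θ k := hγ.self_of_nhds
  have hD : ∀ r, partialDeriv (fun θ' => collisionalState Hc J (γ θ') ψ t r) θ α =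
      sndBlock (liftedState Hc J (γ θ) g ψ t r) := fun r =>
    (hasDerivAt_collisionalState hHc J (γ := fun τ => γ (θ + τ • Pi.single α 1)) (by simp)
      (eventually_line hγ _) (fun k => hasDerivAt_partialDeriv (hγd k) α) ψ t r).deriv
  have hc : ∀ k, Continuous fun s => probeExpectation Hc J (γ θ) ψ s (star (J k) * J k) :=
    fun k => continuous_probeExpectation hHc J (γ θ) ψ _
  have hexp : ∀ s, probeExpectation Hc J (γ θ) ψ s
      (∑ k, ((g k ^ 2 : ℝ) : ℂ) • (star (J k) * J k)) =
      ∑ k, ((g k ^ 2 : ℝ) : ℂ) * probeExpectation Hc J (γ θ) ψ s (star (J k) * J k) := by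
    intro s
    obtain ⟨ω, hω⟩ := exists_linearMap_probeExpectation hHc J (γ θ) ψ s
    simp [hω]
  simp only [collisionalQFI, pureQFI, Matrix.of_apply, hD,
    fockInner_collisionalState_sndBlock hHc hHc' J hγ0, mul_zero, sub_zero,
    fockInner_sndBlock_sndBlock hHc hHc' J hγ0, hexp]
  rw [intervalIntegral.integral_finsetSum fun k _ =>
    ((hc k).const_mul _).intervalIntegrable 0 t, Complex.re_sum, Finset.mul_sum]
  refine Finset.sum_congr rfl fun k _ => ?_
  rw [intervalIntegral.integral_const_mul, Complex.re_ofReal_mul, mul_assoc]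
  congr 2
  exact (Complex.reCLM.intervalIntegral_comp_comm ((hc k).intervalIntegrable 0 t)).symm

theorem paramAverage_collisionalQFI (hγ : ∀ᶠ θ' in 𝓝 θ, ∀ k, 0 ≤ γ θ' k)
    (hγd : ∀ k, DifferentiableAt ℝ (fun θ' => Real.sqrt (γ θ' k)) θ)
    (hHc : LocallyIntegrable Hc volume) (hHc' : ∀ t, IsSelfAdjoint (Hc t))
    (J : Fin R → H →L[ℂ] H) (ψ : H) (t : ℝ) :
    paramAverage (collisionalQFI Hc J γ θ ψ t) =
      ∫ s in (0 : ℝ)..t, (probeExpectation Hc J (γ θ) ψ s (rateOperator J γ θ)).re := by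
  have hc : ∀ k, Continuous fun s => (probeExpectation Hc J (γ θ) ψ s (star (J k) * J k)).re :=
    fun k => Complex.continuous_re.comp (continuous_probeExpectation hHc J (γ θ) ψ _)
  have hexp : ∀ s, (probeExpectation Hc J (γ θ) ψ s (rateOperator J γ θ)).re =
      ∑ k, rateWeight γ θ k * (probeExpectation Hc J (γ θ) ψ s (star (J k) * J k)).re := by
    intro s
    obtain ⟨ω, hω⟩ := exists_linearMap_probeExpectation hHc J (γ θ) ψ s
    simp [hω, rateOperator]
  simp only [hexp]
  rw [intervalIntegral.integral_finsetSum fun k _ =>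
    ((hc k).const_mul _).intervalIntegrable 0 t]
  simp only [paramAverage, Matrix.trace, Matrix.diag_apply,
    collisionalQFI_diag hγ hγd hHc hHc' J ψ t, intervalIntegral.integral_const_mul, rateWeight]
  rw [Finset.sum_comm, Finset.sum_div]
  refine Finset.sum_congr rfl fun k _ => ?_
  rw [← Finset.sum_mul]
  ring

theorem rateWeight_nonneg (γ : (Fin d → ℝ) → Fin R → ℝ) (θ : Fin d → ℝ) (k : Fin R) :
    0 ≤ rateWeight γ θ k :=
  div_nonneg (Finset.sum_nonneg fun _ _ => by positivity) (Nat.cast_nonneg _)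

open scoped ComplexOrder in
theorem rateOperator_nonneg (J : Fin R → H →L[ℂ] H) (γ : (Fin d → ℝ) → Fin R → ℝ)
    (θ : Fin d → ℝ) : 0 ≤ rateOperator J γ θ :=
  Finset.sum_nonneg fun k _ => smul_nonneg
    (Complex.zero_le_real.2 (rateWeight_nonneg γ θ k)) (star_mul_self_nonneg _)

/-- The expectation is positive and normalized, and `A ≤ ‖A‖`. The control enters only through the
state, so it cannot exceed this bound. -/
theorem probeExpectation_rateOperator_re_le (hγ : ∀ k, 0 ≤ γ θ k)
    (hHc : LocallyIntegrable Hc volume) (hHc' : ∀ t, IsSelfAdjoint (Hc t))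
    (J : Fin R → H →L[ℂ] H) {ψ : H} (hψ : ‖ψ‖ = 1) {t : ℝ} (ht : 0 ≤ t) :
    (probeExpectation Hc J (γ θ) ψ t (rateOperator J γ θ)).re ≤ ‖rateOperator J γ θ‖ := by
  set A := rateOperator J γ θ with hA
  have hle : A ≤ (‖A‖ : ℂ) • (1 : H →L[ℂ] H) := by
    have := IsSelfAdjoint.le_algebraMap_norm_self (rateOperator_nonneg J γ θ).isSelfAdjoint
    rwa [Algebra.algebraMap_eq_smul_one] at this
  have h := probeExpectation_re_nonneg hHc J (γ θ) ψ ht (sub_nonneg.2 hle)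
  have h1 := probeExpectation_one hHc hHc' J hγ ψ t
  obtain ⟨ω, hω⟩ := exists_linearMap_probeExpectation hHc J (γ θ) ψ t
  rw [hω] at h1 h ⊢
  rw [map_sub, map_smul, h1, hψ] at h
  simpa using h

/-- The fundamental theorem of calculus at `0` for the continuous integrand `⟨A⟩_s`. -/
theorem tendsto_collisionalQFI_rate (hγ : ∀ᶠ θ' in 𝓝 θ, ∀ k, 0 ≤ γ θ' k)
    (hγd : ∀ k, DifferentiableAt ℝ (fun θ' => Real.sqrt (γ θ' k)) θ)
    (hHc : LocallyIntegrable Hc volume) (hHc' : ∀ t, IsSelfAdjoint (Hc t))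
    (J : Fin R → H →L[ℂ] H) (ψ : H) :
    Tendsto (fun t : ℝ => paramAverage (collisionalQFI Hc J γ θ ψ t) / t) (𝓝[>] 0)
      (𝓝 (inner ℂ ψ (rateOperator J γ θ ψ)).re) := by
  have hc : Continuous fun s => (probeExpectation Hc J (γ θ) ψ s (rateOperator J γ θ)).re :=
    Complex.continuous_re.comp (continuous_probeExpectation hHc J (γ θ) ψ _)
  have h := hc.integral_hasStrictDerivAt 0 0 |>.hasDerivAt
  rw [hasDerivAt_iff_tendsto_slope_zero, probeExpectation_zero_time hHc] at h
  refine (h.mono_left (nhdsWithin_mono _ fun t ht => ne_of_gt ht)).congr fun t => ?_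
  rw [paramAverage_collisionalQFI hγ hγd hHc hHc', zero_add, integral_same, sub_zero, smul_eq_mul,
    div_eq_inv_mul]

/-- Time averages of `⟨A⟩` are at most `‖A‖`. Conversely, an upper bound `b` of the rates also
bounds their short-time limits `⟨ψ, A ψ⟩`. -/
theorem isLUB_qfiRates [Nontrivial H] (hγ : ∀ᶠ θ' in 𝓝 θ, ∀ k, 0 ≤ γ θ' k)
    (hγd : ∀ k, DifferentiableAt ℝ (fun θ' => Real.sqrt (γ θ' k)) θ)
    (hHc : LocallyIntegrable Hc volume) (hHc' : ∀ t, IsSelfAdjoint (Hc t))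
    (J : Fin R → H →L[ℂ] H) : IsLUB (qfiRates Hc J γ θ) ‖rateOperator J γ θ‖ := by
  have hc : ∀ ψ, Continuous fun s =>
      (probeExpectation Hc J (γ θ) ψ s (rateOperator J γ θ)).re := fun ψ =>
    Complex.continuous_re.comp (continuous_probeExpectation hHc J (γ θ) ψ _)
  refine ⟨?_, fun b hb => ?_⟩
  · rintro _ ⟨t, ht, ψ, hψ, rfl⟩
    rw [paramAverage_collisionalQFI hγ hγd hHc hHc', div_le_iff₀ ht]
    calc _ ≤ ∫ _ in (0 : ℝ)..t, ‖rateOperator J γ θ‖ :=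
          integral_mono_on ht.le ((hc ψ).intervalIntegrable _ _) intervalIntegrable_const
            fun s hs => probeExpectation_rateOperator_re_le hγ.self_of_nhds hHc hHc' J hψ hs.1
      _ = _ := by simp [mul_comm]
  · have hle : ∀ ψ : H, ‖ψ‖ = 1 → (inner ℂ ψ (rateOperator J γ θ ψ)).re ≤ b := fun ψ hψ =>
      le_of_tendsto (tendsto_collisionalQFI_rate hγ hγd hHc hHc' J ψ)
        (eventually_mem_nhdsWithin.mono fun t ht => hb ⟨t, ht, ψ, hψ, rfl⟩)
    have hA := rateOperator_nonneg J γ θ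
    have hb0 : 0 ≤ b := by
      obtain ⟨ψ, hψ⟩ := exists_norm_eq H zero_le_one
      exact (((ContinuousLinearMap.nonneg_iff_isPositive _).1 hA).re_inner_nonneg_right ψ).trans
        (hle ψ hψ)
    -- For `A ≥ 0` and `b ≥ 0`, the bound `‖A‖ ≤ b` is the operator inequality `A ≤ b`, which is
    -- tested on normalized vectors.
    rw [CStarAlgebra.norm_le_iff_le_algebraMap _ hb0 hA, ContinuousLinearMap.le_def,
      ContinuousLinearMap.isPositive_def']
    refine ⟨(IsSelfAdjoint.algebraMap _ (IsSelfAdjoint.all b)).sub hA.isSelfAdjoint, fun x => ?_⟩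
    have hx : (inner ℂ x (rateOperator J γ θ x)).re ≤ b * ‖x‖ ^ 2 := by
      rcases eq_or_ne x 0 with rfl | hx0
      · simp
      have hn : ‖x‖ ≠ 0 := norm_ne_zero_iff.2 hx0
      have h := hle (((‖x‖⁻¹ : ℝ) : ℂ) • x) (by simp [norm_smul, hn])
      rw [map_smul, inner_smul_left, inner_smul_right, Complex.conj_ofReal, Complex.re_ofReal_mul,
        Complex.re_ofReal_mul] at h
      calc _ = ‖x‖ ^ 2 * (‖x‖⁻¹ * (‖x‖⁻¹ * (inner ℂ x (rateOperator J γ θ x)).re)) := by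
            field_simp
        _ ≤ ‖x‖ ^ 2 * b := by gcongr
        _ = _ := mul_comm _ _
    have e : ((algebraMap ℝ (H →L[ℂ] H) b - rateOperator J γ θ).reApplyInnerSelf x) =
        b * ‖x‖ ^ 2 - (inner ℂ x (rateOperator J γ θ x)).re := by
      rw [ContinuousLinearMap.reApplyInnerSelf_apply, Algebra.algebraMap_eq_smul_one, sub_apply,
        inner_sub_left, map_sub]
      congr 1
      · rw [smul_apply, one_apply_eq_self, ← Complex.coe_smul, inner_smul_left, Complex.conj_ofReal,
          inner_self_eq_norm_sq_to_K]
        simp [← Complex.ofReal_pow]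
      · exact inner_re_symm (𝕜 := ℂ) _ _
    rw [e]
    linarith

end QFI

end NoiseMetrology

namespace NoiseMetrology

open Set

/-! ### Short-time asymptotics of exponential families -/

section ExpAsymptotics

variable {𝔸 : Type*} [NormedRing 𝔸] [NormedAlgebra ℝ 𝔸] [CompleteSpace 𝔸] {a b c : 𝔸}

theorem contDiff_normedSpace_exp : ContDiff ℝ 2 (NormedSpace.exp : 𝔸 → 𝔸) :=
  contDiff_iff_contDiffAt.2 fun x =>
    (NormedSpace.exp_analytic (𝕂 := ℝ) x).contDiffAt

theorem hasFDerivAt_normedSpace_exp (x : 𝔸) :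
    HasFDerivAt NormedSpace.exp (fderiv ℝ (NormedSpace.exp : 𝔸 → 𝔸) x) x :=
  (contDiff_normedSpace_exp.differentiable two_ne_zero x).hasFDerivAt

theorem fderiv_normedSpace_exp_zero : fderiv ℝ (NormedSpace.exp : 𝔸 → 𝔸) 0 = 1 :=
  hasFDerivAt_exp_zero.fderiv

/-- The exponential and its derivative, to second order near `0`. -/
theorem exists_norm_exp_add_sub_le : ∃ C r : ℝ, 0 ≤ C ∧ 0 < r ∧ ∀ u h : 𝔸, ‖u‖ < r → ‖h‖ < r →
    ‖NormedSpace.exp (u + h) - NormedSpace.exp u - fderiv ℝ NormedSpace.exp u h‖ ≤ C * ‖h‖ ^ 2 ∧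
    ‖fderiv ℝ (NormedSpace.exp : 𝔸 → 𝔸) u - 1‖ ≤ C * ‖u‖ := by
  have h1 : ContDiffAt ℝ 1 (fderiv ℝ (NormedSpace.exp : 𝔸 → 𝔸)) 0 :=
    contDiff_normedSpace_exp.contDiffAt.fderiv_right (by norm_num)
  obtain ⟨C, s, hs, hC⟩ := h1.exists_lipschitzOnWith
  obtain ⟨r, hr, hrs⟩ := Metric.mem_nhds_iff.1 hs
  -- Half the radius keeps the ball of radius `‖h‖` around `u` inside the region where the
  -- derivative is Lipschitz.
  refine ⟨C, r / 2, C.2, by positivity, fun u h hu hh => ⟨?_, ?_⟩⟩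
  · have hmem : ∀ x ∈ Metric.closedBall u ‖h‖, x ∈ s := fun x hx => hrs <| by
      rw [mem_closedBall_iff_norm] at hx
      rw [mem_ball_zero_iff]
      calc ‖x‖ = ‖(x - u) + u‖ := by rw [sub_add_cancel]
        _ ≤ ‖x - u‖ + ‖u‖ := norm_add_le _ _
        _ < r := by linarith
    have key := (convex_closedBall u ‖h‖).norm_image_sub_le_of_norm_hasFDerivWithin_le'
      (𝕜 := ℝ) (f := NormedSpace.exp) (f' := fderiv ℝ NormedSpace.exp)
      (φ := fderiv ℝ NormedSpace.exp u) (C := C * ‖h‖) (x := u) (y := u + h)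
      (fun x _ => (hasFDerivAt_normedSpace_exp x).hasFDerivWithinAt)
      (fun x hx => (hC.norm_sub_le (hmem x hx)
        (hmem u (Metric.mem_closedBall_self (norm_nonneg _)))).trans (by
          rw [mem_closedBall_iff_norm] at hx
          gcongr))
      (Metric.mem_closedBall_self (norm_nonneg _)) (by simp)
    rw [add_sub_cancel_left] at key
    calc _ ≤ _ := key
      _ = _ := by ring
  · have := hC.norm_sub_le (hrs (by rw [mem_ball_zero_iff]; linarith) : u ∈ s) (mem_of_mem_nhds hs)
    rwa [fderiv_normedSpace_exp_zero, sub_zero] at this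

/-- The derivative of `ℓ (exp (t a))` when `a` varies at rate `b`. -/
noncomputable def expVariation (ℓ : 𝔸 →L[ℝ] ℝ) (a b : 𝔸) (t : ℝ) : ℝ :=
  ℓ (fderiv ℝ NormedSpace.exp (t • a) (t • b))

variable (ℓ : 𝔸 →L[ℝ] ℝ)

theorem hasDerivAt_expVariation {f : ℝ → 𝔸} (hf : HasDerivAt f b 0) (h0 : f 0 = a) (t : ℝ) :
    HasDerivAt (fun τ => ℓ (NormedSpace.exp (t • f τ))) (expVariation ℓ a b t) 0 := by
  have h1 : HasDerivAt (fun τ => t • f τ) (t • b) 0 := hf.const_smul t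
  have h2 : HasFDerivAt NormedSpace.exp (fderiv ℝ (NormedSpace.exp : 𝔸 → 𝔸) (t • a)) (t • f 0) := by
    rw [h0]; exact hasFDerivAt_normedSpace_exp _
  exact ℓ.hasFDerivAt.comp_hasDerivAt 0 (h2.comp_hasDerivAt 0 h1)

theorem tendsto_expVariation_div (a b : 𝔸) :
    Tendsto (fun t => expVariation ℓ a b t / t) (𝓝[>] 0) (𝓝 (ℓ b)) := by
  have hc : Continuous fun t : ℝ => ℓ (fderiv ℝ (NormedSpace.exp : 𝔸 → 𝔸) (t • a) b) :=
    ℓ.continuous.comp (((contDiff_normedSpace_exp.continuous_fderiv two_ne_zero).comp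
      (continuous_id.smul continuous_const)).clm_apply continuous_const)
  have h := (hc.tendsto 0).mono_left (nhdsWithin_le_nhds (s := Ioi 0))
  simp only [zero_smul, fderiv_normedSpace_exp_zero, one_apply_eq_self] at h
  refine h.congr' ?_
  filter_upwards [self_mem_nhdsWithin] with t ht
  rw [expVariation, map_smul, map_smul, smul_eq_mul, mul_div_cancel_left₀ _ (ne_of_gt ht)]

theorem tendsto_exp_smul (a : 𝔸) :
    Tendsto (fun t : ℝ => ℓ (NormedSpace.exp (t • a))) (𝓝[>] 0) (𝓝 (ℓ 1)) := by
  have hc : Continuous fun t : ℝ => ℓ (NormedSpace.exp (t • a)) :=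
    ℓ.continuous.comp (contDiff_normedSpace_exp.continuous.comp
      (continuous_id.smul continuous_const))
  simpa using (hc.tendsto 0).mono_left (nhdsWithin_le_nhds (s := Ioi 0))

theorem tendsto_exp_smul_div (a : 𝔸) (h1 : ℓ 1 = 0) :
    Tendsto (fun t : ℝ => ℓ (NormedSpace.exp (t • a)) / t) (𝓝[>] 0) (𝓝 (ℓ a)) := by
  have h : HasDerivAt (fun t : ℝ => ℓ (NormedSpace.exp (t • a))) (ℓ a) 0 := by
    have := ℓ.hasFDerivAt.comp_hasDerivAt 0 (hasDerivAt_exp_smul_const a (0 : ℝ))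
    rwa [zero_smul, NormedSpace.exp_zero, one_mul] at this
  rw [hasDerivAt_iff_tendsto_slope_zero] at h
  refine (h.mono_left (nhdsWithin_mono _ fun t ht => ne_of_gt ht)).congr fun t => ?_
  simp [h1, div_eq_inv_mul]

/-- Here `p` behaves like `t ℓ(a)` and `p'` like `t ℓ(b)`, so `p'² / p` is linear in `t` to leading
order. -/
theorem tendsto_fisher_of_pos (h1 : ℓ 1 = 0) (ha : 0 < ℓ a) (b : 𝔸) :
    Tendsto (fun t : ℝ => expVariation ℓ a b t * expVariation ℓ a b t /
      ℓ (NormedSpace.exp (t • a)) / t) (𝓝[>] 0) (𝓝 (ℓ b * ℓ b / ℓ a)) := by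
  have h := ((tendsto_expVariation_div ℓ a b).mul (tendsto_expVariation_div ℓ a b)).div
    (tendsto_exp_smul_div ℓ a h1) ha.ne'
  refine h.congr' ?_
  filter_upwards [self_mem_nhdsWithin] with t ht
  have ht' : t ≠ 0 := ne_of_gt ht
  by_cases hp : ℓ (NormedSpace.exp (t • a)) = 0
  -- If the probability vanishes, both sides are `0` by the convention for division by zero.
  · simp [hp]
  · simp only [Pi.div_apply]
    field_simp

/-- The probability has a nonzero limit while `p'² = O(t²)`. -/
theorem tendsto_fisher_of_apply_one_ne_zero (h1 : ℓ 1 ≠ 0) (a b : 𝔸) :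
    Tendsto (fun t : ℝ => expVariation ℓ a b t * expVariation ℓ a b t /
      ℓ (NormedSpace.exp (t • a)) / t) (𝓝[>] 0) (𝓝 0) := by
  have ht0 : Tendsto (fun t : ℝ => t) (𝓝[>] 0) (𝓝 0) := nhdsWithin_le_nhds
  have h := (((tendsto_expVariation_div ℓ a b).mul (tendsto_expVariation_div ℓ a b)).mul ht0).div
    (tendsto_exp_smul ℓ a) h1
  rw [mul_zero, zero_div] at h
  refine h.congr' ?_
  filter_upwards [self_mem_nhdsWithin] with t ht
  have ht' : t ≠ 0 := ne_of_gt ht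
  by_cases hp : ℓ (NormedSpace.exp (t • a)) = 0
  · simp [hp]
  · simp only [Pi.div_apply]
    field_simp

/-- An outcome of vanishing rate to first order carries no information to first order: the
probability stays nonnegative along `x ↦ a + x b + x² c`, which bounds its derivative. -/
theorem tendsto_fisher_of_apply_eq_zero (hb : ℓ b = 0) (hc : ℓ c = 0)
    (hpos : ∀ t : ℝ, 0 ≤ t → ∀ x : ℝ, 0 ≤ ℓ (NormedSpace.exp (t • (a + x • b + x ^ 2 • c)))) :
    Tendsto (fun t : ℝ => expVariation ℓ a b t * expVariation ℓ a b t /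
      ℓ (NormedSpace.exp (t • a)) / t) (𝓝[>] 0) (𝓝 0) := by
  obtain ⟨C, r, hC0, hr, hC⟩ := exists_norm_exp_add_sub_le (𝔸 := 𝔸)
  set M := 1 + ‖a‖ + ‖b‖ + ‖c‖ with hM
  have hMa : ‖a‖ ≤ M := by have := norm_nonneg b; have := norm_nonneg c; linarith
  have hMb : ‖b‖ ≤ M := by have := norm_nonneg a; have := norm_nonneg c; linarith
  have hMc : ‖c‖ ≤ M := by have := norm_nonneg b; have := norm_nonneg a; linarith
  have hMbc : ‖b‖ + ‖c‖ ≤ M := by have := norm_nonneg a; linarith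
  have hM0 : 0 < M := by positivity
  -- One multiple of `‖ℓ‖ C M²` absorbs the second-order remainder of `exp`, the other the term in
  -- `c`; the `1` makes `D` positive.
  set D := 1 + 2 * (‖ℓ‖ * C * M ^ 2) with hD
  have hD0 : 0 < D := by positivity
  have key : ∀ t : ℝ, 0 < t → t * M < r →
      expVariation ℓ a b t ^ 2 ≤ 4 * D * t ^ 2 * ℓ (NormedSpace.exp (t • a)) := by
    intro t ht htr
    have hu : ‖t • a‖ ≤ t * M := by
      rw [norm_smul, Real.norm_of_nonneg ht.le]; gcongr
    -- Since `ℓ y = 0`, only the deviation of the derivative of `exp` from the identity contributes,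
    -- which gains a factor `t`.
    have hlin : ∀ y : 𝔸, ℓ y = 0 → ‖y‖ ≤ M →
        |ℓ (fderiv ℝ NormedSpace.exp (t • a) y)| ≤ ‖ℓ‖ * C * M ^ 2 * t := by
      intro y hy hyM
      have e : ℓ (fderiv ℝ NormedSpace.exp (t • a) y) =
          ℓ ((fderiv ℝ NormedSpace.exp (t • a) - 1) y) := by
        simp [hy]
      rw [e]
      calc _ ≤ ‖ℓ‖ * ‖(fderiv ℝ NormedSpace.exp (t • a) - 1) y‖ := ℓ.le_opNorm _
        _ ≤ ‖ℓ‖ * (‖fderiv ℝ NormedSpace.exp (t • a) - 1‖ * ‖y‖) := by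
          gcongr; exact ContinuousLinearMap.le_opNorm _ _
        _ ≤ ‖ℓ‖ * ((C * (t * M)) * M) := by
          gcongr
          exact (hC (t • a) 0 (hu.trans_lt htr) (by simpa)).2.trans (by gcongr)
        _ = _ := by ring
    set p := ℓ (NormedSpace.exp (t • a)) with hp
    set p' := expVariation ℓ a b t with hp'
    have hp'le : |p'| ≤ D * t ^ 2 := by
      have := hlin b hb hMb
      rw [hp', expVariation, map_smul, map_smul, smul_eq_mul, abs_mul, abs_of_pos ht]
      calc _ ≤ t * (‖ℓ‖ * C * M ^ 2 * t) := by gcongr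
        _ = ‖ℓ‖ * C * M ^ 2 * t ^ 2 := by ring
        _ ≤ D * t ^ 2 := by
          gcongr
          have : 0 ≤ ‖ℓ‖ * C * M ^ 2 := by positivity
          linarith
    have hquad : ∀ x : ℝ, |x| ≤ 1 → 0 ≤ p + x * p' + D * t ^ 2 * x ^ 2 := by
      intro x hx
      set h : 𝔸 := t • (x • b + x ^ 2 • c) with hh
      have hhn : ‖h‖ ≤ t * |x| * M := by
        rw [hh, norm_smul, Real.norm_of_nonneg ht.le]
        calc t * ‖x • b + x ^ 2 • c‖ ≤ t * (|x| * ‖b‖ + |x| * ‖c‖) := by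
              gcongr
              refine (norm_add_le _ _).trans ?_
              rw [norm_smul, norm_smul, Real.norm_eq_abs, Real.norm_eq_abs, abs_pow]
              gcongr
              nlinarith [abs_nonneg x]
          _ = t * |x| * (‖b‖ + ‖c‖) := by ring
          _ ≤ _ := by gcongr
      have hhr : ‖h‖ < r := by
        refine (hhn.trans ?_).trans_lt htr
        calc t * |x| * M ≤ t * 1 * M := by gcongr
          _ = t * M := by ring
      have h2 := (hC (t • a) h (hu.trans_lt htr) hhr).1
      have e1 : ℓ (fderiv ℝ NormedSpace.exp (t • a) h) =
          x * p' + t * x ^ 2 * ℓ (fderiv ℝ NormedSpace.exp (t • a) c) := by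
        rw [hp', expVariation, hh]
        simp only [map_smul, map_add, smul_eq_mul]
        ring
      have e2 : ℓ (NormedSpace.exp (t • a + h)) = p + ℓ (fderiv ℝ NormedSpace.exp (t • a) h) +
          ℓ (NormedSpace.exp (t • a + h) - NormedSpace.exp (t • a) -
            fderiv ℝ NormedSpace.exp (t • a) h) := by
        rw [map_sub, map_sub]; ring
      have h3 : ℓ (NormedSpace.exp (t • a + h) - NormedSpace.exp (t • a) -
            fderiv ℝ NormedSpace.exp (t • a) h) ≤ ‖ℓ‖ * C * M ^ 2 * t ^ 2 * x ^ 2 := by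
        refine (le_abs_self _).trans ((ℓ.le_opNorm _).trans ?_)
        calc _ ≤ ‖ℓ‖ * (C * ‖h‖ ^ 2) := by gcongr
          _ ≤ ‖ℓ‖ * (C * (t * |x| * M) ^ 2) := by gcongr
          _ = _ := by rw [mul_pow, mul_pow, sq_abs]; ring
      have h4 : t * x ^ 2 * ℓ (fderiv ℝ NormedSpace.exp (t • a) c) ≤
          ‖ℓ‖ * C * M ^ 2 * t ^ 2 * x ^ 2 := by
        calc _ ≤ t * x ^ 2 * (‖ℓ‖ * C * M ^ 2 * t) := by
              gcongr; exact (le_abs_self _).trans (hlin c hc hMc)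
          _ = _ := by ring
      have h5 := hpos t ht.le x
      rw [show t • (a + x • b + x ^ 2 • c) = t • a + h by rw [hh, ← smul_add, add_assoc], e2, e1]
        at h5
      have h6 : 0 ≤ t ^ 2 * x ^ 2 := by positivity
      rw [hD]
      nlinarith
    have hE : 0 < D * t ^ 2 := by positivity
    -- The quadratic is evaluated at its vertex, which lies in `[-1, 1]` because `|p'| ≤ D t²`; the
    -- result is the discriminant inequality `p'² ≤ 4 D t² p`.
    have h7 := hquad (-p' / (2 * (D * t ^ 2))) (by
      rw [abs_div, abs_neg, abs_of_pos (by positivity : 0 < 2 * (D * t ^ 2)),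
        div_le_one (by positivity)]
      linarith)
    have h8 : p + -p' / (2 * (D * t ^ 2)) * p' + D * t ^ 2 * (-p' / (2 * (D * t ^ 2))) ^ 2 =
        p - p' ^ 2 / (4 * (D * t ^ 2)) := by
      field_simp
      ring
    rw [h8, sub_nonneg, div_le_iff₀ (by positivity)] at h7
    linarith
  have hup : Tendsto (fun t : ℝ => 4 * D * t) (𝓝[>] 0) (𝓝 0) := by
    have : Tendsto (fun t : ℝ => 4 * D * t) (𝓝 0) (𝓝 (4 * D * 0)) :=
      (continuous_const.mul continuous_id).tendsto 0
    rw [mul_zero] at this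
    exact this.mono_left nhdsWithin_le_nhds
  have hsmall : ∀ᶠ t : ℝ in 𝓝[>] 0, t * M < r := by
    filter_upwards [Ioo_mem_nhdsGT (div_pos hr hM0)] with t ht
    exact (lt_div_iff₀ hM0).1 ht.2
  have hp0 : ∀ t : ℝ, 0 < t → 0 ≤ ℓ (NormedSpace.exp (t • a)) := fun t ht => by
    simpa using hpos t ht.le 0
  refine squeeze_zero' ?_ ?_ hup
  · filter_upwards [self_mem_nhdsWithin] with t ht
    exact div_nonneg (div_nonneg (mul_self_nonneg _) (hp0 t ht)) (le_of_lt ht)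
  · filter_upwards [self_mem_nhdsWithin, hsmall] with t ht htr
    have ht' : 0 < t := ht
    rw [div_le_iff₀ ht', ← sq]
    refine div_le_of_le_mul₀ (hp0 t ht) (by positivity) ?_
    exact (key t ht htr).trans_eq (by ring)

end ExpAsymptotics

/-! ### Outcome probabilities and their Fisher information rates in a complex Banach algebra -/

section ComplexAlgebra

variable {𝔸 : Type*} [NormedRing 𝔸] [NormedAlgebra ℂ 𝔸] [CompleteSpace 𝔸] {R : ℕ}

theorem continuous_normedSpace_exp : Continuous (NormedSpace.exp : 𝔸 → 𝔸) :=
  contDiff_normedSpace_exp.continuous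

theorem exp_add_ofReal_smul_one (a : 𝔸) (r : ℝ) :
    NormedSpace.exp (a + (r : ℂ) • (1 : 𝔸)) = (Real.exp r : ℂ) • NormedSpace.exp a := by
  let _ : NormedAlgebra ℚ 𝔸 := NormedAlgebra.restrictScalars ℚ ℝ 𝔸
  have hone : NormedSpace.exp (r • (1 : 𝔸)) = Real.exp r • 1 := by
    rw [← Algebra.algebraMap_eq_smul_one, ← Algebra.algebraMap_eq_smul_one, Real.exp_eq_exp_ℝ,
      NormedSpace.algebraMap_exp_comm]
  rw [Complex.coe_smul, Complex.coe_smul,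
    NormedSpace.exp_add_of_commute ((Commute.one_right _).smul_right _), hone, mul_smul_comm, mul_one]

/-- A scalar shift of the generator only rescales the exponential by a positive factor, so it does
not affect positivity. -/
theorem exp_smul_of_add_smul_one_eq {a p : 𝔸} {r : ℝ} (h : a + (r : ℂ) • 1 = p) (t : ℝ) :
    NormedSpace.exp ((t : ℂ) • a) =
      (Real.exp (-(t * r)) : ℂ) • NormedSpace.exp ((t : ℂ) • p) := by
  rw [← exp_add_ofReal_smul_one, ← h]
  congr 1
  rw [smul_add, smul_smul, add_assoc, ← add_smul]
  simp

theorem tendsto_exp_smul_add_smul (a q : 𝔸) (t : ℝ) :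
    Tendsto (fun ε : ℝ => NormedSpace.exp ((t : ℂ) • (a + (ε : ℂ) • q))) (𝓝[>] 0)
      (𝓝 (NormedSpace.exp ((t : ℂ) • a))) := by
  have h : Continuous fun ε : ℝ => (t : ℂ) • (a + (ε : ℂ) • q) := by fun_prop
  have := ((continuous_normedSpace_exp.comp h).tendsto 0).mono_left
    (nhdsWithin_le_nhds (s := Ioi 0))
  simpa [Function.comp_def] using this

theorem hasSum_exp_smul (z : ℂ) (a : 𝔸) :
    HasSum (fun n : ℕ => ((n.factorial : ℂ)⁻¹ * z ^ n) • a ^ n) (NormedSpace.exp (z • a)) := by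
  have := NormedSpace.exp_series_hasSum_exp' (𝕂 := ℂ) (z • a)
  simpa only [smul_pow, smul_smul] using this

/-- The probability `Re ℓ (exp (t ∑_k γ_k T_k))` of an outcome at time `t`, for the rates `γ_k`. -/
noncomputable def outcomeProb (T : Fin R → 𝔸) (ℓ : 𝔸 →L[ℂ] ℂ) (t : ℝ) (γ : Fin R → ℝ) : ℝ :=
  (ℓ (NormedSpace.exp ((t : ℂ) • ∑ k, (γ k : ℂ) • T k))).re

/-- The contribution of an outcome to the Fisher information per unit time. -/
noncomputable def outcomeFisherRate (T : Fin R → 𝔸) (ℓ : 𝔸 →L[ℂ] ℂ) (γ : ℝ → Fin R → ℝ)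
    (t : ℝ) : ℝ :=
  deriv (fun τ => outcomeProb T ℓ t (γ τ)) 0 * deriv (fun τ => outcomeProb T ℓ t (γ τ)) 0 /
    outcomeProb T ℓ t (γ 0) / t

/-- The real part of a complex functional, as a real functional. -/
noncomputable def reFunctional (ℓ : 𝔸 →L[ℂ] ℂ) : 𝔸 →L[ℝ] ℝ :=
  Complex.reCLM.comp (ℓ.restrictScalars ℝ)

omit [CompleteSpace 𝔸] in
theorem reFunctional_sum (ℓ : 𝔸 →L[ℂ] ℂ) (T : Fin R → 𝔸) (γ : Fin R → ℝ) :
    reFunctional ℓ (∑ k, (γ k : ℂ) • T k) = ∑ k, γ k * (ℓ (T k)).re := by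
  simp [reFunctional]

omit [CompleteSpace 𝔸] in
theorem outcomeProb_eq (T : Fin R → 𝔸) (ℓ : 𝔸 →L[ℂ] ℂ) (t : ℝ) (γ : Fin R → ℝ) :
    outcomeProb T ℓ t γ =
      reFunctional ℓ (NormedSpace.exp (t • ∑ k, (γ k : ℂ) • T k)) := by
  rw [outcomeProb, Complex.coe_smul]
  rfl

variable {T : Fin R → 𝔸} {ℓ : 𝔸 →L[ℂ] ℂ} {γ : ℝ → Fin R → ℝ} {γ' : Fin R → ℝ}

theorem outcomeFisherRate_eq (hγ : ∀ k, HasDerivAt (fun τ => γ τ k) (γ' k) 0) :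
    outcomeFisherRate T ℓ γ = fun t =>
      expVariation (reFunctional ℓ) (∑ k, (γ 0 k : ℂ) • T k) (∑ k, (γ' k : ℂ) • T k) t *
        expVariation (reFunctional ℓ) (∑ k, (γ 0 k : ℂ) • T k) (∑ k, (γ' k : ℂ) • T k) t /
        reFunctional ℓ (NormedSpace.exp (t • ∑ k, (γ 0 k : ℂ) • T k)) / t := by
  have h : HasDerivAt (fun τ => ∑ k, (γ τ k : ℂ) • T k) (∑ k, (γ' k : ℂ) • T k) 0 :=
    HasDerivAt.fun_sum fun k _ => (hγ k).ofReal_comp.smul_const _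
  funext t
  simp only [outcomeFisherRate, outcomeProb_eq]
  rw [(hasDerivAt_expVariation (reFunctional ℓ) h rfl t).deriv]

theorem tendsto_outcomeFisherRate_of_apply_one_ne_zero
    (hγ : ∀ k, HasDerivAt (fun τ => γ τ k) (γ' k) 0) (h1 : (ℓ 1).re ≠ 0) :
    Tendsto (outcomeFisherRate T ℓ γ) (𝓝[>] 0) (𝓝 0) := by
  rw [outcomeFisherRate_eq hγ]
  exact tendsto_fisher_of_apply_one_ne_zero (reFunctional ℓ) h1 _ _

theorem tendsto_outcomeFisherRate_of_pos
    (hγ : ∀ k, HasDerivAt (fun τ => γ τ k) (γ' k) 0) (h1 : (ℓ 1).re = 0)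
    (hpos : 0 < ∑ k, γ 0 k * (ℓ (T k)).re) :
    Tendsto (outcomeFisherRate T ℓ γ) (𝓝[>] 0)
      (𝓝 ((∑ k, γ' k * (ℓ (T k)).re) ^ 2 / ∑ k, γ 0 k * (ℓ (T k)).re)) := by
  rw [outcomeFisherRate_eq hγ, ← reFunctional_sum, ← reFunctional_sum, sq]
  exact tendsto_fisher_of_pos (reFunctional ℓ) h1 (by rwa [reFunctional_sum]) _

/-- With `g_k` the derivative of `√γ_k`, this covers outcomes that fire to first order only through
channels with `g_k = 0`, or through none. -/
theorem tendsto_outcomeFisherRate_of_eq_zero {g : Fin R → ℝ}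
    (hγ : ∀ k, HasDerivAt (fun τ => γ τ k) (2 * (Real.sqrt (γ 0 k) * g k)) 0)
    (hγ0 : ∀ k, 0 ≤ γ 0 k) (hg : ∀ k, g k * (ℓ (T k)).re = 0)
    (hpos : ∀ t : ℝ, 0 ≤ t → ∀ c : Fin R → ℝ, (∀ k, 0 ≤ c k) → 0 ≤ outcomeProb T ℓ t c) :
    Tendsto (outcomeFisherRate T ℓ γ) (𝓝[>] 0) (𝓝 0) := by
  rw [outcomeFisherRate_eq hγ]
  refine tendsto_fisher_of_apply_eq_zero (c := ∑ k, ((g k ^ 2 : ℝ) : ℂ) • T k) (reFunctional ℓ)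
    ?_ ?_ fun t ht x => ?_
  · rw [reFunctional_sum]
    exact Finset.sum_eq_zero fun k _ => by rw [← mul_assoc, mul_assoc, hg, mul_zero]
  · rw [reFunctional_sum]
    exact Finset.sum_eq_zero fun k _ => by rw [sq, mul_assoc, hg, mul_zero]
  -- The rates `(√γ_k + x g_k)²` are nonnegative for every real `x` and expand to `γ_k + 2x √γ_k g_k
  -- + x² g_k²`, the required path `a + x b + x² c`.
  · have h := hpos t ht (fun k => (Real.sqrt (γ 0 k) + x * g k) ^ 2) fun k => sq_nonneg _
    rw [outcomeProb_eq] at h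
    convert! h using 4
    simp only [← Complex.coe_smul, Finset.smul_sum, smul_smul, ← Finset.sum_add_distrib, ← add_smul]
    refine Finset.sum_congr rfl fun k _ => ?_
    congr 1
    have := Real.sq_sqrt (hγ0 k)
    rw [← this, Real.sqrt_sq (Real.sqrt_nonneg _)]
    push_cast
    ring

end ComplexAlgebra

/-! ### The Lindblad semigroup in the Heisenberg picture -/

section Heisenberg

variable {H : Type*} [NormedAddCommGroup H] [InnerProductSpace ℂ H] [CompleteSpace H] {R : ℕ}

/-- The superoperator `ρ ↦ X ρ Y - ½ {Y X, ρ}`, as a bilinear function of `X` and `Y`. -/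
noncomputable def dissipatorForm :
    (H →L[ℂ] H) →ₗ[ℂ] (H →L[ℂ] H) →ₗ[ℂ] ((H →L[ℂ] H) →L[ℂ] (H →L[ℂ] H)) :=
  LinearMap.mk₂ ℂ (fun X Y => ContinuousLinearMap.mulLeftRight ℂ (H →L[ℂ] H) X Y
      - (1 / 2 : ℂ) • (ContinuousLinearMap.mul ℂ (H →L[ℂ] H) (Y * X)
        + (ContinuousLinearMap.mul ℂ (H →L[ℂ] H)).flip (Y * X)))
    (fun X X' Y => by simp only [map_add, add_apply, mul_add, smul_add]; abel)
    (fun c X Y => by simp only [map_smul, smul_apply, mul_smul_comm, smul_sub, smul_add, smul_comm c])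
    (fun X Y Y' => by simp only [map_add, add_mul, smul_add]; abel)
    (fun c X Y => by simp only [map_smul, smul_mul_assoc, smul_sub, smul_add, smul_comm c])

theorem dissipatorForm_apply (X Y ρ : H →L[ℂ] H) :
    dissipatorForm X Y ρ = X * ρ * Y - (1 / 2 : ℂ) • (Y * X * ρ + ρ * (Y * X)) := by
  simp [dissipatorForm]

/-- The dissipator in diagonal form. -/
theorem dissipator_dissipationMatrix (L : Fin R → H →L[ℂ] H) (V : Matrix (Fin R) (Fin R) ℂ)
    (γ : Fin R → ℝ) : dissipator L (dissipationMatrix V γ) =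
      ∑ k, (γ k : ℂ) • dissipatorForm (canonicalJump L V k) (star (canonicalJump L V k)) := by
  have h1 : dissipator L (dissipationMatrix V γ) =
      ∑ i, ∑ j, ∑ k, (γ k * V i k * star (V j k)) • dissipatorForm (L i) (star (L j)) := by
    rw [dissipator]
    refine Finset.sum_congr rfl fun i _ => Finset.sum_congr rfl fun j _ => ?_
    rw [← Finset.sum_smul]
    congr 1
    rw [dissipationMatrix, Matrix.mul_apply]
    refine Finset.sum_congr rfl fun k _ => ?_
    rw [Matrix.mul_diagonal, Matrix.conjTranspose_apply]
    ring
  rw [h1]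
  simp only [canonicalJump, star_sum, star_smul, map_sum, map_smul, LinearMap.sum_apply,
    LinearMap.smul_apply, Finset.smul_sum, smul_smul]
  rw [Finset.sum_congr rfl fun i _ => Finset.sum_comm, Finset.sum_comm]
  refine Finset.sum_congr rfl fun k _ => ?_
  rw [Finset.sum_comm]
  refine Finset.sum_congr rfl fun j _ => Finset.sum_congr rfl fun i _ => ?_
  congr 1
  ring

/-- The adjoint `X ↦ J† X J - ½ {J† J, X}` of the dissipator of a single jump operator. -/
noncomputable def dissipatorAdjoint (J : H →L[ℂ] H) : (H →L[ℂ] H) →L[ℂ] (H →L[ℂ] H) :=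
  ContinuousLinearMap.mulLeftRight ℂ (H →L[ℂ] H) (star J) J
    - (1 / 2 : ℂ) • (ContinuousLinearMap.mul ℂ (H →L[ℂ] H) (star J * J)
      + (ContinuousLinearMap.mul ℂ (H →L[ℂ] H)).flip (star J * J))

theorem dissipatorAdjoint_apply (J X : H →L[ℂ] H) : dissipatorAdjoint J X =
    star J * X * J - (1 / 2 : ℂ) • (star J * J * X + X * (star J * J)) := by
  simp [dissipatorAdjoint]

/-- The adjoint of the dissipator with jump operators `J_k` and rates `γ_k`. -/
noncomputable def lindbladAdjoint (J : Fin R → H →L[ℂ] H) (γ : Fin R → ℝ) :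
    (H →L[ℂ] H) →L[ℂ] (H →L[ℂ] H) :=
  ∑ k, (γ k : ℂ) • dissipatorAdjoint (J k)

open scoped ComplexOrder in
-- The exponential series has nonnegative coefficients, and powers of a positive map are positive.
theorem exp_smul_apply_nonneg_of_nonneg {P : (H →L[ℂ] H) →L[ℂ] (H →L[ℂ] H)}
    (hP : ∀ X, 0 ≤ X → 0 ≤ P X) {X : H →L[ℂ] H} (hX : 0 ≤ X) : 0 ≤ NormedSpace.exp P X := by
  have h := (ContinuousLinearMap.apply ℂ (H →L[ℂ] H) X).hasSum
    (NormedSpace.exp_series_hasSum_exp' (𝕂 := ℂ) P)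
  refine h.nonneg fun n => ?_
  have hn : ∀ n : ℕ, 0 ≤ (P ^ n) X := by
    intro n
    induction n with
    | zero => simpa using hX
    | succ n ih => rw [pow_succ', mul_apply_eq_comp]; exact hP _ ih
  simp only [ContinuousLinearMap.apply_apply, smul_apply]
  exact smul_nonneg (inv_nonneg.2 (Nat.cast_nonneg _)) (hn n)

open scoped ComplexOrder in
/-- The Lindblad semigroup is positive. -/
theorem exp_lindbladAdjoint_nonneg (J : Fin R → H →L[ℂ] H) {γ : Fin R → ℝ} (hγ : ∀ k, 0 ≤ γ k)
    {t : ℝ} (ht : 0 ≤ t) {X : H →L[ℂ] H} (hX : 0 ≤ X) :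
    0 ≤ NormedSpace.exp ((t : ℂ) • lindbladAdjoint J γ) X := by
  set K : H →L[ℂ] H := -((1 / 2 : ℂ) • ∑ k, (γ k : ℂ) • (star (J k) * J k)) with hK
  have hKs : star K = K := by
    simp [hK, star_sum, star_smul]
  -- Completing the square: adding `ε K X K + ε⁻¹ X` to the generator gives `∑ γ_k J_k† X J_k + ε⁻¹
  -- (1 + ε K) X (1 + ε K)`, a positive map. The term in `ε⁻¹` is a harmless scalar shift, and `ε →
  -- 0` removes the rest.
  set Q : (H →L[ℂ] H) →L[ℂ] (H →L[ℂ] H) := ContinuousLinearMap.mulLeftRight ℂ (H →L[ℂ] H) K K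
    with hQ
  have hpos : ∀ ε : ℝ, 0 < ε →
      0 ≤ NormedSpace.exp ((t : ℂ) • (lindbladAdjoint J γ + (ε : ℂ) • Q)) X := by
    intro ε hε
    set P : (H →L[ℂ] H) →L[ℂ] (H →L[ℂ] H) :=
      ∑ k, (γ k : ℂ) • ContinuousLinearMap.mulLeftRight ℂ (H →L[ℂ] H) (star (J k)) (J k) +
        ((ε⁻¹ : ℝ) : ℂ) • ContinuousLinearMap.mulLeftRight ℂ (H →L[ℂ] H) (star (1 + (ε : ℂ) • K)) (1 + (ε : ℂ) • K) with hP
    have hPX : ∀ X, 0 ≤ X → 0 ≤ ((t : ℂ) • P) X := by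
      intro X hX
      simp only [hP, smul_apply, add_apply, sum_apply, ContinuousLinearMap.mulLeftRight_apply]
      refine smul_nonneg (Complex.zero_le_real.2 ht) (add_nonneg (Finset.sum_nonneg fun k _ =>
        smul_nonneg (Complex.zero_le_real.2 (hγ k)) (star_left_conjugate_nonneg hX _))
        (smul_nonneg (Complex.zero_le_real.2 (inv_nonneg.2 hε.le)) (star_left_conjugate_nonneg hX _)))
    have e : lindbladAdjoint J γ + (ε : ℂ) • Q +
        ((ε⁻¹ : ℝ) : ℂ) • (1 : (H →L[ℂ] H) →L[ℂ] (H →L[ℂ] H)) = P := by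
      refine ContinuousLinearMap.ext fun X => ?_
      have hs : (lindbladAdjoint J γ) X =
          ∑ k, (γ k : ℂ) • (star (J k) * X * J k) + (K * X + X * K) := by
        simp only [lindbladAdjoint, sum_apply, smul_apply, dissipatorAdjoint_apply, hK,
          smul_sub, Finset.sum_sub_distrib, neg_mul, mul_neg, Finset.mul_sum, Finset.sum_mul,
          smul_mul_assoc, mul_smul_comm, smul_add, Finset.sum_add_distrib, Finset.smul_sum,
          smul_comm (γ _ : ℂ) (1 / 2 : ℂ)]
        abel
      have h2 : ((ε⁻¹ : ℝ) : ℂ) • (star (1 + (ε : ℂ) • K) * X * (1 + (ε : ℂ) • K)) =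
          ((ε⁻¹ : ℝ) : ℂ) • X + (K * X + X * K) + (ε : ℂ) • (K * X * K) := by
        have hε' : ((ε⁻¹ : ℝ) : ℂ) * ε = 1 := by
          rw [← Complex.ofReal_mul, inv_mul_cancel₀ hε.ne', Complex.ofReal_one]
        simp only [star_add, star_one, star_smul, hKs, Complex.star_def, Complex.conj_ofReal,
          add_mul, mul_add, one_mul, mul_one, smul_mul_assoc, mul_smul_comm, smul_add, smul_smul,
          ← mul_assoc, hε', one_smul]
        abel
      simp only [add_apply, smul_apply, hs, hP, sum_apply, hQ,
        ContinuousLinearMap.mulLeftRight_apply, one_apply_eq_self, h2]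
      abel
    rw [exp_smul_of_add_smul_one_eq e, smul_apply]
    exact smul_nonneg (Complex.zero_le_real.2 (Real.exp_pos _).le)
      (exp_smul_apply_nonneg_of_nonneg hPX hX)
  have hlim := ((ContinuousLinearMap.apply ℂ (H →L[ℂ] H) X).continuous.tendsto _).comp
    (tendsto_exp_smul_add_smul (lindbladAdjoint J γ) Q t)
  exact ge_of_tendsto hlim (by
    filter_upwards [self_mem_nhdsWithin] with ε hε using hpos ε hε)

theorem lindbladAdjoint_one (J : Fin R → H →L[ℂ] H) (γ : Fin R → ℝ) :
    lindbladAdjoint J γ 1 = 0 := by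
  rw [lindbladAdjoint, sum_apply]
  refine Finset.sum_eq_zero fun k _ => ?_
  rw [smul_apply, dissipatorAdjoint_apply, mul_one, mul_one, one_mul, ← two_smul ℂ, smul_smul]
  norm_num

/-- The Lindblad semigroup is unital. -/
theorem exp_lindbladAdjoint_one (J : Fin R → H →L[ℂ] H) (γ : Fin R → ℝ) (t : ℝ) :
    NormedSpace.exp ((t : ℂ) • lindbladAdjoint J γ) 1 = 1 := by
  have h := (ContinuousLinearMap.apply ℂ (H →L[ℂ] H) 1).hasSum
    (NormedSpace.exp_series_hasSum_exp' (𝕂 := ℂ) ((t : ℂ) • lindbladAdjoint J γ))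
  have h0 : ∀ n : ℕ, n ≠ 0 → (ContinuousLinearMap.apply ℂ (H →L[ℂ] H) 1)
      ((n.factorial : ℂ)⁻¹ • ((t : ℂ) • lindbladAdjoint J γ) ^ n) = 0 := by
    intro n hn
    obtain ⟨m, rfl⟩ := Nat.exists_eq_succ_of_ne_zero hn
    rw [ContinuousLinearMap.apply_apply, smul_apply, pow_succ, mul_apply_eq_comp, smul_apply,
      lindbladAdjoint_one, smul_zero, map_zero, smul_zero]
  have := h.unique (hasSum_single 0 h0)
  simpa using this

open InnerProductSpace in
/-- Duality of the Schrödinger and the Heisenberg picture, on rank one operators. -/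
theorem inner_pow_dissipator (J : Fin R → H →L[ℂ] H) (γ : Fin R → ℝ) (ψ : H) (n : ℕ) (x y : H) :
    inner ℂ x (((∑ k, (γ k : ℂ) • dissipatorForm (J k) (star (J k))) ^ n) (rankOne ℂ ψ ψ) y) =
      inner ℂ ψ ((lindbladAdjoint J γ ^ n) (rankOne ℂ y x) ψ) := by
  induction n generalizing x y with
  | zero => simp [mul_comm]
  | succ n ih =>
    rw [pow_succ', mul_apply_eq_comp, pow_succ, mul_apply_eq_comp]
    set ρ := ((∑ k, (γ k : ℂ) • dissipatorForm (J k) (star (J k))) ^ n) (rankOne ℂ ψ ψ)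
    -- The adjoint sends a rank one operator to a combination of rank one operators, so the
    -- induction hypothesis for all `x`, `y` suffices.
    have hD : lindbladAdjoint J γ (rankOne ℂ y x) = ∑ k, (γ k : ℂ) •
        (rankOne ℂ (star (J k) y) (star (J k) x) -
          (1 / 2 : ℂ) • (rankOne ℂ ((star (J k) * J k) y) x +
            rankOne ℂ y ((star (J k) * J k) x))) := by
      simp only [lindbladAdjoint, sum_apply, smul_apply, dissipatorAdjoint_apply]
      refine Finset.sum_congr rfl fun k _ => ?_
      congr 1
      refine ContinuousLinearMap.ext fun z => ?_
      simp [ContinuousLinearMap.star_eq_adjoint, ContinuousLinearMap.adjoint_inner_left,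
        ContinuousLinearMap.adjoint_inner_right]
    rw [hD]
    simp only [sum_apply, smul_apply, dissipatorForm_apply, sub_apply, add_apply, map_sum, map_smul,
      map_sub, map_add, inner_sum, inner_smul_right, inner_sub_right, inner_add_right, ← ih,
      mul_apply_eq_comp]
    refine Finset.sum_congr rfl fun k _ => ?_
    simp only [ContinuousLinearMap.star_eq_adjoint, ContinuousLinearMap.adjoint_inner_left,
      ContinuousLinearMap.adjoint_inner_right]
    ring

open InnerProductSpace in
-- Matrix elements of the state become expectations of evolved rank one operators, which avoids
-- traces in infinite dimension.
theorem inner_lindbladState (L : Fin R → H →L[ℂ] H) (V : Matrix (Fin R) (Fin R) ℂ)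
    (γ : Fin R → ℝ) (ψ : H) (t : ℝ) (x y : H) :
    inner ℂ x (lindbladState L (dissipationMatrix V γ) ψ t y) =
      inner ℂ ψ (NormedSpace.exp ((t : ℂ) • lindbladAdjoint (canonicalJump L V) γ)
        (rankOne ℂ y x) ψ) := by
  rw [lindbladState, dissipator_dissipationMatrix]
  set D := ∑ k, (γ k : ℂ) • dissipatorForm (canonicalJump L V k) (star (canonicalJump L V k))
  set D' := lindbladAdjoint (canonicalJump L V) γ
  have h1 := ((innerSL ℂ x).comp ((ContinuousLinearMap.apply ℂ H y).comp
    (ContinuousLinearMap.apply ℂ (H →L[ℂ] H) (rankOne ℂ ψ ψ)))).hasSum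
    (hasSum_exp_smul (t : ℂ) D)
  have h2 := ((innerSL ℂ ψ).comp ((ContinuousLinearMap.apply ℂ H ψ).comp
    (ContinuousLinearMap.apply ℂ (H →L[ℂ] H) (rankOne ℂ y x)))).hasSum
    (hasSum_exp_smul (t : ℂ) D')
  refine h1.unique (h2.congr_fun fun n => ?_)
  simp only [ContinuousLinearMap.comp_apply, ContinuousLinearMap.apply_apply, innerSL_apply_apply,
    smul_apply, inner_smul_right]
  rw [inner_pow_dissipator]

end Heisenberg

/-! ### Rapid prepare-and-measure -/

section RapidPrepareMeasure

variable {H : Type*} [NormedAddCommGroup H] [InnerProductSpace ℂ H] [CompleteSpace H] {R d : ℕ}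

open InnerProductSpace in
/-- The effects of the jump POVM. -/
noncomputable def jumpEffect (J : Fin R → H →L[ℂ] H) (ψ : H) :
    Option (Option (Fin R)) → H →L[ℂ] H
  | some (some k) => rankOne ℂ (jumpVector J ψ k) (jumpVector J ψ k)
  | some none => rankOne ℂ ψ ψ
  | none => 1 - rankOne ℂ ψ ψ - ∑ k, rankOne ℂ (jumpVector J ψ k) (jumpVector J ψ k)

/-- The functional `S ↦ ⟨ψ, S(E) ψ⟩` on superoperators. -/
noncomputable def effectFunctional (ψ : H) (E : H →L[ℂ] H) :
    ((H →L[ℂ] H) →L[ℂ] (H →L[ℂ] H)) →L[ℂ] ℂ :=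
  (innerSL ℂ ψ).comp ((ContinuousLinearMap.apply ℂ H ψ).comp
    (ContinuousLinearMap.apply ℂ (H →L[ℂ] H) E))

theorem effectFunctional_apply (ψ : H) (E : H →L[ℂ] H) (S : (H →L[ℂ] H) →L[ℂ] (H →L[ℂ] H)) :
    effectFunctional ψ E S = inner ℂ ψ (S E ψ) := by
  simp [effectFunctional]

/-- For the complementary outcome, the `1` in its probability is the evolved identity, by unitality
and `‖ψ‖ = 1`. -/
theorem jumpProb_lindbladState (L : Fin R → H →L[ℂ] H) (V : Matrix (Fin R) (Fin R) ℂ) {ψ : H}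
    (hψ : ‖ψ‖ = 1) (γ : Fin R → ℝ) (t : ℝ) (o : Option (Option (Fin R))) :
    jumpProb (canonicalJump L V) ψ (lindbladState L (dissipationMatrix V γ) ψ t) o =
      outcomeProb (fun k => dissipatorAdjoint (canonicalJump L V k))
        (effectFunctional ψ (jumpEffect (canonicalJump L V) ψ o)) t γ := by
  rw [outcomeProb, effectFunctional_apply]
  match o with
  | some (some k) =>
    simp only [jumpProb, inner_lindbladState]
    rfl
  | some none =>
    simp only [jumpProb, inner_lindbladState]
    rfl
  | none =>
    have h1 : NormedSpace.exp ((t : ℂ) • ∑ k, (γ k : ℂ) • dissipatorAdjoint (canonicalJump L V k)) 1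
        = 1 := exp_lindbladAdjoint_one (canonicalJump L V) γ t
    have h2 : inner ℂ ψ ψ = (1 : ℂ) := by rw [inner_self_eq_norm_sq_to_K, hψ]; simp
    simp only [jumpProb, inner_lindbladState, jumpEffect, map_sub, map_sum, sub_apply, sum_apply,
      inner_sub_right, inner_sum, Complex.sub_re, Complex.re_sum, h1, one_apply_eq_self, h2,
      Complex.one_re]
    rfl

/-- An effect that annihilates `ψ` kills the anticommutator; only the jump term reaches it to first
order. -/
theorem effectFunctional_dissipatorAdjoint {ψ : H} {E : H →L[ℂ] H} (hE : IsSelfAdjoint E)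
    (h : E ψ = 0) (J : H →L[ℂ] H) :
    effectFunctional ψ E (dissipatorAdjoint J) = inner ℂ (J ψ) (E (J ψ)) := by
  have h0 : ∀ x, inner ℂ ψ (E x) = (0 : ℂ) := fun x => by
    rw [← ContinuousLinearMap.adjoint_inner_left, ← ContinuousLinearMap.star_eq_adjoint, hE.star_eq,
      h, inner_zero_left]
  rw [effectFunctional_apply, dissipatorAdjoint_apply]
  simp only [sub_apply, smul_apply, add_apply, mul_apply_eq_comp, inner_sub_right, inner_smul_right,
    inner_add_right, h0, h, map_zero, inner_zero_right, add_zero, mul_zero, sub_zero,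
    ContinuousLinearMap.star_eq_adjoint, ContinuousLinearMap.adjoint_inner_right]

variable {J : Fin R → H →L[ℂ] H} {ψ : H}

theorem re_inner_star_mul_self (J : H →L[ℂ] H) (ψ : H) :
    (inner ℂ ψ ((star J * J) ψ)).re = ‖J ψ‖ ^ 2 := by
  rw [mul_apply_eq_comp, ContinuousLinearMap.star_eq_adjoint,
    ContinuousLinearMap.adjoint_inner_right, inner_self_eq_norm_sq_to_K]
  simp [← Complex.ofReal_pow]

theorem norm_smul_jumpVector (J : Fin R → H →L[ℂ] H) (ψ : H) (k : Fin R) :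
    (‖J k ψ‖ : ℂ) • jumpVector J ψ k = J k ψ := by
  rw [jumpVector, re_inner_star_mul_self, Real.sqrt_sq (norm_nonneg _), smul_smul]
  rcases eq_or_ne (J k ψ) 0 with h | h
  · simp [h]
  · rw [← Complex.ofReal_mul, mul_one_div_cancel (norm_ne_zero_iff.2 h)]
    simp

/-- If `J_k ψ = 0`, the normalized jump vector would be `0`, not a unit vector; so `μ_k ≠ 0` is part
of the distinguishability condition. -/
theorem HasDistinguishableJumps.norm_apply_pos (h : HasDistinguishableJumps J ψ) (k : Fin R) :
    0 < ‖J k ψ‖ := by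
  refine norm_pos_iff.2 fun h0 => ?_
  have := h.1.1 k
  simp [jumpVector, h0] at this

theorem HasDistinguishableJumps.inner_jumpVector_apply (h : HasDistinguishableJumps J ψ)
    (l k : Fin R) : inner ℂ (jumpVector J ψ l) (J k ψ) = if l = k then (‖J k ψ‖ : ℂ) else 0 := by
  rw [← norm_smul_jumpVector J ψ k, inner_smul_right, orthonormal_iff_ite.1 h.1,
    norm_smul_jumpVector]
  simp

theorem HasDistinguishableJumps.orthonormal_option (h : HasDistinguishableJumps J ψ)
    (hψ : ‖ψ‖ = 1) : Orthonormal ℂ (fun o : Option (Fin R) => o.elim ψ (jumpVector J ψ)) := by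
  refine ⟨fun o => ?_, fun o o' hne => ?_⟩
  · cases o with
    | none => exact hψ
    | some k => exact h.1.1 k
  · cases o with
    | none =>
      cases o' with
      | none => exact absurd rfl hne
      | some k => exact h.2 k
    | some k =>
      cases o' with
      | none => exact inner_eq_zero_symm.1 (h.2 k)
      | some l => exact h.1.2 fun e => hne (congrArg some e)

open InnerProductSpace in
-- For the complementary effect this is Bessel's inequality for the orthonormal family of `ψ` and
-- the `j_k`.
theorem HasDistinguishableJumps.jumpEffect_nonneg (h : HasDistinguishableJumps J ψ)
    (hψ : ‖ψ‖ = 1) (o : Option (Option (Fin R))) : 0 ≤ jumpEffect J ψ o := by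
  have hr : ∀ x : H, 0 ≤ rankOne ℂ x x := fun x =>
    (ContinuousLinearMap.nonneg_iff_isPositive _).2 (isPositive_rankOne_self x)
  match o with
  | some (some k) => exact hr _
  | some none => exact hr _
  | none =>
    have hs : IsSelfAdjoint (jumpEffect J ψ none) :=
      ((IsSelfAdjoint.one _).sub (hr ψ).isSelfAdjoint).sub
        (isSelfAdjoint_sum _ fun k _ => (hr _).isSelfAdjoint)
    rw [ContinuousLinearMap.nonneg_iff_isPositive, ContinuousLinearMap.isPositive_def']
    refine ⟨hs, fun x => ?_⟩
    have hB := (h.orthonormal_option hψ).sum_inner_products_le x (s := Finset.univ)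
    have hq : ∀ y : H, (inner ℂ (rankOne ℂ y y x) x).re = ‖(inner ℂ y x : ℂ)‖ ^ 2 := fun y => by
      rw [rankOne_apply, inner_smul_left, Complex.conj_mul']
      simp [← Complex.ofReal_pow]
    rw [Fintype.sum_option] at hB
    simp only [Option.elim] at hB
    rw [ContinuousLinearMap.reApplyInnerSelf_apply]
    simp only [jumpEffect, sub_apply, sum_apply, inner_sub_left, sum_inner, one_apply_eq_self,
      RCLike.re_to_complex, Complex.sub_re, Complex.re_sum, hq]
    rw [inner_self_eq_norm_sq_to_K]
    simp only [Complex.coe_algebraMap, ← Complex.ofReal_pow, Complex.ofReal_re]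
    linarith

theorem HasDistinguishableJumps.outcomeProb_nonneg (h : HasDistinguishableJumps J ψ)
    (hψ : ‖ψ‖ = 1) (o : Option (Option (Fin R))) {t : ℝ} (ht : 0 ≤ t) {γ : Fin R → ℝ}
    (hγ : ∀ k, 0 ≤ γ k) :
    0 ≤ outcomeProb (fun k => dissipatorAdjoint (J k))
      (effectFunctional ψ (jumpEffect J ψ o)) t γ := by
  rw [outcomeProb, effectFunctional_apply]
  exact ((ContinuousLinearMap.nonneg_iff_isPositive _).1
    (exp_lindbladAdjoint_nonneg J hγ ht (h.jumpEffect_nonneg hψ o))).re_inner_nonneg_right ψ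

theorem HasDistinguishableJumps.jumpEffect_apply_self (h : HasDistinguishableJumps J ψ)
    (hψ : ‖ψ‖ = 1) {o : Option (Option (Fin R))} (ho : o ≠ some none) : jumpEffect J ψ o ψ = 0 := by
  have h0 : ∀ k, inner ℂ (jumpVector J ψ k) ψ = (0 : ℂ) := fun k => inner_eq_zero_symm.1 (h.2 k)
  match o with
  | some (some k) => simp [jumpEffect, h0]
  | some none => exact absurd rfl ho
  | none =>
    simp [jumpEffect, h0, inner_self_eq_norm_sq_to_K, hψ]

/-- Orthonormality makes detector `l` respond, to first order, to channel `l` alone. -/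
theorem HasDistinguishableJumps.effectFunctional_some_some (h : HasDistinguishableJumps J ψ)
    (hψ : ‖ψ‖ = 1) (l k : Fin R) :
    (effectFunctional ψ (jumpEffect J ψ (some (some l))) (dissipatorAdjoint (J k))).re =
      if l = k then ‖J k ψ‖ ^ 2 else 0 := by
  rw [effectFunctional_dissipatorAdjoint (h.jumpEffect_nonneg hψ _).isSelfAdjoint
    (h.jumpEffect_apply_self hψ (by simp))]
  simp only [jumpEffect, InnerProductSpace.rankOne_apply, inner_smul_right]
  rw [← inner_conj_symm (J k ψ), h.inner_jumpVector_apply]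
  split_ifs
  · simp [sq]
  · simp

/-- `J_k ψ` is a multiple of `j_k`, hence invisible to `Π_⊥`. -/
theorem HasDistinguishableJumps.effectFunctional_none (h : HasDistinguishableJumps J ψ)
    (hψ : ‖ψ‖ = 1) (k : Fin R) :
    effectFunctional ψ (jumpEffect J ψ none) (dissipatorAdjoint (J k)) = 0 := by
  rw [effectFunctional_dissipatorAdjoint (h.jumpEffect_nonneg hψ _).isSelfAdjoint
    (h.jumpEffect_apply_self hψ (by simp))]
  have h0 : inner ℂ ψ (J k ψ) = (0 : ℂ) := by
    rw [← norm_smul_jumpVector, inner_smul_right, h.2, mul_zero]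
  have : jumpEffect J ψ none (J k ψ) = 0 := by
    simp only [jumpEffect, sub_apply, sum_apply, InnerProductSpace.rankOne_apply, h0, zero_smul,
      h.inner_jumpVector_apply, ite_smul, one_apply_eq_self, Finset.sum_ite_eq', Finset.mem_univ,
      if_true, norm_smul_jumpVector, sub_zero, sub_self]
  rw [this, inner_zero_right]

/-- The limit of the Fisher information rate carried by an outcome of the jump POVM, when the
square roots of the rates vary with derivatives `g_k`. -/
noncomputable def jumpFisherRate (J : Fin R → H →L[ℂ] H) (ψ : H) (g : Fin R → ℝ) :
    Option (Option (Fin R)) → ℝ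
  | some (some k) => 4 * g k ^ 2 * ‖J k ψ‖ ^ 2
  | _ => 0

/-- Three regimes: survival has probability near one, `Π_⊥` has vanishing first-order rate, and
click `l` has rate `γ_l ‖J_l ψ‖²`. -/
theorem HasDistinguishableJumps.tendsto_outcomeFisherRate (h : HasDistinguishableJumps J ψ)
    (hψ : ‖ψ‖ = 1) {γ : ℝ → Fin R → ℝ} {g : Fin R → ℝ} (hγ : ∀ᶠ τ in 𝓝 0, ∀ k, 0 ≤ γ τ k)
    (hg : ∀ k, HasDerivAt (fun τ => Real.sqrt (γ τ k)) (g k) 0) (o : Option (Option (Fin R))) :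
    Tendsto (outcomeFisherRate (fun k => dissipatorAdjoint (J k))
      (effectFunctional ψ (jumpEffect J ψ o)) γ) (𝓝[>] 0) (𝓝 (jumpFisherRate J ψ g o)) := by
  have hγ' : ∀ k, HasDerivAt (fun τ => γ τ k) (2 * (Real.sqrt (γ 0 k) * g k)) 0 := fun k =>
    hasDerivAt_of_sqrt (hγ.mono fun τ h => h k) (hg k)
  have hγ0 : ∀ k, 0 ≤ γ 0 k := hγ.self_of_nhds
  have hpos : ∀ t : ℝ, 0 ≤ t → ∀ c : Fin R → ℝ, (∀ k, 0 ≤ c k) → 0 ≤ outcomeProb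
      (fun k => dissipatorAdjoint (J k)) (effectFunctional ψ (jumpEffect J ψ o)) t c :=
    fun t ht c hc => h.outcomeProb_nonneg hψ o ht hc
  have hone : o ≠ some none → (effectFunctional ψ (jumpEffect J ψ o) 1).re = 0 := fun ho => by
    rw [effectFunctional_apply, one_apply_eq_self, h.jumpEffect_apply_self hψ ho, inner_zero_right,
      Complex.zero_re]
  match o with
  | some none =>
    refine tendsto_outcomeFisherRate_of_apply_one_ne_zero hγ' ?_
    rw [effectFunctional_apply, one_apply_eq_self]
    simp [jumpEffect, inner_self_eq_norm_sq_to_K, hψ]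
  | none =>
    exact tendsto_outcomeFisherRate_of_eq_zero hγ' hγ0
      (fun k => by rw [h.effectFunctional_none hψ, Complex.zero_re, mul_zero]) hpos
  | some (some l) =>
    have hsum : ∀ c : Fin R → ℝ, ∑ k, c k * (effectFunctional ψ (jumpEffect J ψ (some (some l)))
        (dissipatorAdjoint (J k))).re = c l * ‖J l ψ‖ ^ 2 := fun c => by
      simp [h.effectFunctional_some_some hψ]
    have hμ := h.norm_apply_pos l
    -- If `γ_l` vanishes at the true point, `√γ_l` has a minimum there, so `g_l = 0` and the click
    -- falls under the zero-rate case.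
    rcases (hγ0 l).eq_or_lt with h0 | h0
    · have hgl : g l = 0 := by
        refine IsLocalMin.hasDerivAt_eq_zero (f := fun τ => Real.sqrt (γ τ l)) ?_ (hg l)
        refine Eventually.of_forall fun τ => ?_
        simp only [← h0, Real.sqrt_zero]
        exact Real.sqrt_nonneg _
      have := tendsto_outcomeFisherRate_of_eq_zero hγ' hγ0 (fun k => by
        rw [h.effectFunctional_some_some hψ]
        split_ifs with hk
        · rw [← hk, hgl, zero_mul]
        · rw [mul_zero]) hpos
      simpa [jumpFisherRate, hgl] using this
    -- With `μ = ‖J_l ψ‖²`, the limit is `(2 √γ_l g_l μ)² / (γ_l μ) = 4 g_l² μ`.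
    · have := tendsto_outcomeFisherRate_of_pos hγ' (hone (by simp)) (by
        rw [hsum]; positivity)
      rw [hsum, hsum] at this
      convert! this using 2
      rw [jumpFisherRate]
      have h1 := Real.sq_sqrt (hγ0 l)
      field_simp
      rw [h1]
      ring

theorem re_inner_rateOperator (J : Fin R → H →L[ℂ] H) (γ : (Fin d → ℝ) → Fin R → ℝ)
    (θ : Fin d → ℝ) (ψ : H) :
    (inner ℂ ψ (rateOperator J γ θ ψ)).re = ∑ k, rateWeight γ θ k * ‖J k ψ‖ ^ 2 := by
  simp only [rateOperator, sum_apply, smul_apply, inner_sum, Complex.re_sum, inner_smul_right,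
    Complex.re_ofReal_mul, re_inner_star_mul_self]

/-- The Fisher information rate of rapid prepare-and-measure, at short times. -/
theorem HasDistinguishableJumps.tendsto_rpmFisher_rate {L : Fin R → H →L[ℂ] H}
    {V : Matrix (Fin R) (Fin R) ℂ} (h : HasDistinguishableJumps (canonicalJump L V) ψ)
    (hψ : ‖ψ‖ = 1) {γ : (Fin d → ℝ) → Fin R → ℝ} {θ : Fin d → ℝ}
    (hγ : ∀ᶠ θ' in 𝓝 θ, ∀ k, 0 ≤ γ θ' k)
    (hγd : ∀ k, DifferentiableAt ℝ (fun θ' => Real.sqrt (γ θ' k)) θ) :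
    Tendsto (fun δt : ℝ => paramAverage (rpmFisher L V γ θ ψ δt) / δt) (𝓝[>] 0)
      (𝓝 (inner ℂ ψ (rateOperator (canonicalJump L V) γ θ ψ)).re) := by
  have key := (tendsto_finsetSum Finset.univ fun α _ =>
    tendsto_finsetSum Finset.univ fun o _ => h.tendsto_outcomeFisherRate hψ
      (γ := fun τ => γ (θ + τ • Pi.single α 1)) (eventually_line hγ _)
      (fun k => hasDerivAt_partialDeriv (hγd k) α) o).div_const (d : ℝ)
  have hlim : (∑ α, ∑ o, jumpFisherRate (canonicalJump L V) ψ
      (fun k => partialDeriv (fun θ' => Real.sqrt (γ θ' k)) θ α) o) / (d : ℝ) =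
      (inner ℂ ψ (rateOperator (canonicalJump L V) γ θ ψ)).re := by
    rw [re_inner_rateOperator]
    simp only [Fintype.sum_option, jumpFisherRate, zero_add, rateWeight]
    rw [Finset.sum_comm, Finset.sum_div]
    refine Finset.sum_congr rfl fun k _ => ?_
    rw [← Finset.sum_mul, div_mul_eq_mul_div]
  rw [← hlim]
  refine key.congr fun t => ?_
  simp only [paramAverage, Matrix.trace, Matrix.diag_apply, rpmFisher, classicalFisher,
      Matrix.of_apply, jumpProb_lindbladState L V hψ]
  rw [div_right_comm]
  congr 1
  rw [Finset.sum_div]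
  refine Finset.sum_congr rfl fun α _ => ?_
  rw [Finset.sum_div]
  refine Finset.sum_congr rfl fun o _ => ?_
  simp only [outcomeFisherRate, zero_smul, add_zero]
  rfl

end RapidPrepareMeasure

end NoiseMetrology

/-! ### The main theorem -/

theorem theorem3
    {H : Type*} [NormedAddCommGroup H] [InnerProductSpace ℂ H] [CompleteSpace H] [Nontrivial H]
    {R d : ℕ}
    -- local jump operators, parameter-independent eigenframe, eigenrates
    (L : Fin R → H →L[ℂ] H)
    (V : Matrix (Fin R) (Fin R) ℂ) (hV : V ∈ Matrix.unitaryGroup (Fin R) ℂ)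
    (γ : (Fin d → ℝ) → Fin R → ℝ) (θ : Fin d → ℝ)
    (hγ : ∀ᶠ θ' in 𝓝 θ, ∀ k, 0 ≤ γ θ' k)
    (hγd : ∀ k, DifferentiableAt ℝ (fun θ' => Real.sqrt (γ θ' k)) θ)
    -- parameter-independent control Hamiltonian
    (Hc : ℝ → H →L[ℂ] H) (hHc : LocallyIntegrable Hc volume)
    (hHc' : ∀ t, IsSelfAdjoint (Hc t)) :
    let J := NoiseMetrology.canonicalJump L V
    let A := NoiseMetrology.rateOperator J γ θ
    let Rstar := NoiseMetrology.optimalRate Hc J γ θ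
    -- the optimal rate (a genuine supremum) is the largest spectral value of `A ≥ 0`
    A.IsPositive ∧
    IsLUB (NoiseMetrology.qfiRates Hc J γ θ) Rstar ∧
    IsGreatest (spectrum ℝ A) Rstar ∧
    -- the rate of a probe `ψ` tends to `⟨ψ, A ψ⟩` at short times
    (∀ ψ : H, ‖ψ‖ = 1 →
      Tendsto (fun t : ℝ =>
          NoiseMetrology.paramAverage (NoiseMetrology.collisionalQFI Hc J γ θ ψ t) / t)
        (𝓝[>] 0) (𝓝 (inner ℂ ψ (A ψ)).re)) ∧
    -- a maximizing probe with distinguishable jumps attains the optimal rate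
    (∀ ψ : H, ‖ψ‖ = 1 → (inner ℂ ψ (A ψ)).re = Rstar →
      NoiseMetrology.HasDistinguishableJumps J ψ →
      Tendsto (fun δt : ℝ =>
          NoiseMetrology.paramAverage (NoiseMetrology.rpmFisher L V γ θ ψ δt) / δt)
        (𝓝[>] 0) (𝓝 Rstar) ∧
      -- `ν` shots of duration `T / ν`, in a total time `T`
      ∀ T : ℝ, 0 < T →
        Tendsto (fun ν : ℕ =>
            (ν : ℝ) * NoiseMetrology.paramAverage (NoiseMetrology.rpmFisher L V γ θ ψ (T / ν)))
          atTop (𝓝 (T * Rstar))) := by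
  intro J A Rstar
  have hLUB : IsLUB (NoiseMetrology.qfiRates Hc J γ θ) ‖A‖ :=
    NoiseMetrology.isLUB_qfiRates hγ hγd hHc hHc' J
  have hR : Rstar = ‖A‖ := by
    obtain ⟨ψ, hψ⟩ := exists_norm_eq H zero_le_one
    exact hLUB.csSup_eq ⟨_, 1, one_pos, ψ, hψ, rfl⟩
  have hA : 0 ≤ A := NoiseMetrology.rateOperator_nonneg J γ θ
  refine ⟨(ContinuousLinearMap.nonneg_iff_isPositive A).1 hA, hR ▸ hLUB, ?_,
    fun ψ _ => NoiseMetrology.tendsto_collisionalQFI_rate hγ hγd hHc hHc' J ψ,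
    fun ψ hψ hmax hj => ?_⟩
  · rw [hR]
    -- The norm of a positive element belongs to its spectrum, and no spectral value exceeds the
    -- norm.
    exact ⟨CStarAlgebra.norm_mem_spectrum_of_nonneg hA,
      fun x hx => (le_abs_self x).trans (spectrum.norm_le_norm_of_mem hx)⟩
  · have hlim : Tendsto (fun δt : ℝ =>
        NoiseMetrology.paramAverage (NoiseMetrology.rpmFisher L V γ θ ψ δt) / δt)
        (𝓝[>] 0) (𝓝 Rstar) := hmax ▸ hj.tendsto_rpmFisher_rate hψ hγ hγd
    refine ⟨hlim, fun T hT => ?_⟩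
    -- With `δt = T / ν`, the total `ν F̄(δt)` equals `T · F̄(δt) / δt`.
    have hν : Tendsto (fun ν : ℕ => T / ν) atTop (𝓝[>] 0) :=
      tendsto_nhdsWithin_iff.2 ⟨tendsto_const_div_atTop_nhds_zero_nat T, by
        filter_upwards [eventually_gt_atTop 0] with ν hν
        exact div_pos hT (Nat.cast_pos.2 hν)⟩
    refine ((hlim.comp hν).const_mul T).congr' ?_
    filter_upwards [eventually_gt_atTop 0] with ν hν
    have : (ν : ℝ) ≠ 0 := by positivity
    simp only [Function.comp_apply]
    field_simp
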